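/- For a scheme $S$, the pro-étale site $S_{\mathrm{pét}}$ is the category of weakly étale $S$-schemes, with coverings the jointly surjective families $\{U_i\to X\}$ such that every affine open of $X$ is the image of finitely many affine opens of the $U_i$. A hypercovering of $S$ is a simplicial object $U_\bullet$ of $S_{\mathrm{pét}}$ such that $U_0\to S$ and all $U_{n+1}\to \mathrm{cosk}_n(U_\bullet)_{n+1}$, $n\ge 0$, are coverings. Let $\mathrm{Ho}(\mathrm{Hy}(S))$ be the category of hypercoverings with morphisms taken modulo the equivalence relation generated by simplicial homotopy, and $\mathrm{Ho}(\mathrm{sTop})$ the homotopy category of simplicial topological spaces defined in the same way. Let $\pi(X)$ denote the set of connected components of the space $X$ with the quotient topology. The pro-étale homotopy type of $S$ is the pro-object $\Pi_{\mathrm{pé}}(S)\colon \mathrm{Ho}(\mathrm{Hy}(S))\to \mathrm{Ho}(\mathrm{sTop})$, $U_\bullet\mapsto \pi(U_\bullet)$. An object $W$ of $S_{\mathrm{pét}}$ is weakly contractible (wc) if evaluation at $W$ sends surjections of sheaves of sets on $S_{\mathrm{pét}}$ to surjections of sets. A simplicial object $W_\bullet$ is split if there are objects $N_m$ with maps $N_m\to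 W_m$ exhibiting each $W_n$ as the coproduct of the $N_m$ over all surjections $[n]\twoheadrightarrow[m]$ in $\Delta$. The classifying space $BG$ of a discrete group $G$ is the nerve of $G$, regarded as a simplicial discrete space. Let $S=\mathrm{Spec}(\mathbb R)$ and let $W_\bullet=\mathrm{cosk}_0(\mathrm{Spec}(\mathbb C))_\bullet$, formed in $S_{\mathrm{pét}}$. Then: 1. The Galois group $\mathrm{Gal}(\mathbb C/\mathbb R)$ is isomorphic to $\mathbb Z/2\mathbb Z$ and discrete. 2. $W_\bullet$ is a hypercovering of $S$, each $W_n$ is affine and weakly contractible, and $W_\bullet$ is split. 3. The simplicial space underlying $W_\bullet$ is isomorphic to $B\,\mathrm{Gal}(\mathbb C/\mathbb R)$, and the simplicial space $\pi(W_\bullet)$ is isomorphic to $B(\mathbb Z/2\mathbb Z)$. 4. $\mathrm{Ho}(\mathrm{Hy}(S))$ is cofiltered, the inclusion of $W_\bullet$ into it is initial, and the canonical projection $\Pi_{\mathrm{pé}}(S)\to \pi(W_\bullet)$ is an isomorphism of pro-objects in $\mathrm{Ho}(\mathrm{sTop})$. 5. Consequently $\Pi_{\mathrm{pé}}(\mathrm{Spec}\,\mathbb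 R)\cong B(\mathbb Z/2\mathbb Z)$ as pro-objects in $\mathrm{Ho}(\mathrm{sTop})$. -/

import Mathlib

open CategoryTheory CategoryTheory.Limits Opposite AlgebraicGeometry
open scoped Simplicial

namespace ProEtaleHomotopy

universe w' w v u

/-! ### Coskeleta in categories with finite limits -/

section Coskeleta

instance finite_truncated (n : ℕ) : Finite (SimplexCategory.Truncated n) :=
  Finite.of_injective
    (fun X : SimplexCategory.Truncated n => (⟨X.obj.len, Nat.lt_succ_of_le X.property⟩ : Fin (n + 1)))
    (fun X Y h => by
      have h' : X.obj.len = Y.obj.len := congrArg Fin.val h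
      exact ObjectProperty.FullSubcategory.ext (SimplexCategory.ext h'))

instance finite_structuredArrow (n : ℕ) (Y : SimplexCategoryᵒᵖ) :
    Finite (StructuredArrow Y (SimplexCategory.Truncated.inclusion n).op) := by
  let T := Σ X : SimplexCategory.Truncated n,
    ((SimplexCategory.Truncated.inclusion n).obj X ⟶ Y.unop)
  let φ : T → StructuredArrow Y (SimplexCategory.Truncated.inclusion n).op :=
    fun t => StructuredArrow.mk (Y := op t.1) t.2.op
  have hφ : Function.Surjective φ := by
    rintro ⟨⟨⟨⟩⟩, X, f⟩
    exact ⟨⟨X.unop, f.unop⟩, rfl⟩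
  have : ∀ X : SimplexCategory.Truncated n,
    Finite ((SimplexCategory.Truncated.inclusion n).obj X ⟶ Y.unop) := fun _ => inferInstance
  exact Finite.of_surjective φ hφ

instance finite_structuredArrow_hom (n : ℕ) (Y : SimplexCategoryᵒᵖ)
    (A B : StructuredArrow Y (SimplexCategory.Truncated.inclusion n).op) : Finite (A ⟶ B) :=
  Finite.of_injective
    (fun f : A ⟶ B => (SimplexCategory.Truncated.inclusion n).map f.right.unop)
    (fun f g h => by
      apply StructuredArrow.ext
      exact Quiver.Hom.unop_inj ((SimplexCategory.Truncated.inclusion n).map_injective h))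

noncomputable instance finCategory_structuredArrow (n : ℕ) (Y : SimplexCategoryᵒᵖ) :
    FinCategory (StructuredArrow Y (SimplexCategory.Truncated.inclusion n).op) where
  fintypeObj := Fintype.ofFinite _
  fintypeHom _ _ := Fintype.ofFinite _

/-- All coskeleta exist in a category with finite limits (as pointwise Kan extensions). -/
instance hasPointwiseRightKanExtension {C : Type u} [Category.{v} C] [HasFiniteLimits C] (n : ℕ)
    (F : (SimplexCategory.Truncated n)ᵒᵖ ⥤ C) :
    (SimplexCategory.Truncated.inclusion n).op.HasPointwiseRightKanExtension F := by
  intro Y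
  have : HasLimitsOfShape
    (StructuredArrow Y (SimplexCategory.Truncated.inclusion n).op) C := inferInstance
  change HasLimit _
  infer_instance

end Coskeleta

/-! ### Homotopy categories of simplicial objects -/

section HomotopyCategory

variable (C : Type u) [Category.{v} C]

/-- Two morphisms of simplicial objects are related if there is a simplicial homotopy between
them. -/
def homotopyRel : HomRel (SimplicialObject C) :=
  fun _ _ f g => Nonempty (SimplicialObject.Homotopy f g)

/-- The homotopy category of simplicial objects: the same objects, and morphisms are taken modulo
the equivalence relation generated by simplicial homotopy. -/
abbrev Ho : Type (max u v) := CategoryTheory.Quotient (homotopyRel C)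

variable {C}

/-- A simplicial object, viewed as an object of the homotopy category. -/
abbrev toHo (X : SimplicialObject C) : Ho C := (CategoryTheory.Quotient.functor (homotopyRel C)).obj X

/-- The relation of simplicial homotopy on a full subcategory of simplicial objects. -/
def homotopyRelOn (P : ObjectProperty (SimplicialObject C)) : HomRel P.FullSubcategory :=
  fun _ _ f g => Nonempty (SimplicialObject.Homotopy (P.ι.map f) (P.ι.map g))

/-- The homotopy category of a full subcategory of simplicial objects. -/
abbrev HoOn (P : ObjectProperty (SimplicialObject C)) : Type (max u v) :=
  CategoryTheory.Quotient (homotopyRelOn P)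

/-- A functor `C ⥤ D`, applied degreewise, induces a functor on homotopy categories. -/
def HoOn.map {D : Type w} [Category.{w'} D] (P : ObjectProperty (SimplicialObject C))
    (F : C ⥤ D) : HoOn P ⥤ Ho D :=
  CategoryTheory.Quotient.lift (homotopyRelOn P)
    (P.ι ⋙ (SimplicialObject.whiskering C D).obj F ⋙ CategoryTheory.Quotient.functor (homotopyRel D))
    (by
      rintro X Y f g ⟨h⟩
      exact CategoryTheory.Quotient.sound _ ⟨h.whiskerRight F⟩)

end HomotopyCategory

/-! ### Hypercoverings -/

section Hypercoverings

variable {C : Type u} [Category.{v} C] [HasFiniteLimits C]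

/-- A hypercovering of the final object of a site (given by its covering families `K`):
`U₀ ⟶ *` and all the morphisms `Uₙ₊₁ ⟶ (coskₙ U)ₙ₊₁` are coverings. -/
def IsHypercovering (K : Precoverage C) (U : SimplicialObject C) : Prop :=
  Presieve.singleton (terminal.from (U _⦋0⦌)) ∈ K (⊤_ C) ∧
    ∀ n : ℕ, Presieve.singleton (((SimplicialObject.coskAdj n).unit.app U).app (op ⦋n + 1⦌)) ∈
      K (((SimplicialObject.cosk n).obj U) _⦋n + 1⦌)

/-- The simplicial object `cosk₀(X)`: the `0`-coskeleton of the object `X`, viewed as a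
`0`-truncated simplicial object. -/
noncomputable def cosk₀ (X : C) : SimplicialObject C :=
  (SimplicialObject.Truncated.cosk 0).obj ((Functor.const _).obj X)

end Hypercoverings

/-! ### Pro-objects -/

section ProObjects

/-- A pro-object of `C`: a functor to `C` from some cofiltered category. -/
structure ProObject (C : Type u) [Category.{v} C] where
  /-- The index category. -/
  J : Type w
  [category : Category.{w'} J]
  [isCofiltered : IsCofiltered J]
  /-- The underlying diagram. -/
  diagram : J ⥤ C

attribute [instance] ProObject.category ProObject.isCofiltered

namespace ProObject

variable {C : Type u} [Category.{v} C]

/-- The relation generating the equivalence relation that defines `colim_i Hom(X_i, c)`. -/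
def GermRel (X : ProObject.{w', w} C) (c : C) (p q : Σ i : X.J, (X.diagram.obj i ⟶ c)) : Prop :=
  ∃ a : q.1 ⟶ p.1, q.2 = X.diagram.map a ≫ p.2

/-- The colimit `colim_i Hom(X_i, c)`. -/
def Germ (X : ProObject.{w', w} C) (c : C) : Type (max w v) := Quot (GermRel X c)

/-- The class of a morphism `X_i ⟶ c` in `colim_i Hom(X_i, c)`. -/
def Germ.mk {X : ProObject.{w', w} C} {c : C} (i : X.J) (f : X.diagram.obj i ⟶ c) : X.Germ c :=
  Quot.mk _ ⟨i, f⟩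

theorem Germ.mk_map {X : ProObject.{w', w} C} {c : C} {i j : X.J} (a : j ⟶ i)
    (f : X.diagram.obj i ⟶ c) : Germ.mk j (X.diagram.map a ≫ f) = Germ.mk i f :=
  (Quot.sound ⟨a, rfl⟩).symm

/-- Functoriality of `colim_i Hom(X_i, c)` in `c`. -/
def Germ.post {X : ProObject.{w', w} C} {c d : C} (g : c ⟶ d) : X.Germ c → X.Germ d :=
  Quot.map (fun p => ⟨p.1, p.2 ≫ g⟩) (by
    rintro ⟨i, f⟩ ⟨j, f'⟩ ⟨a, h⟩
    dsimp only at h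
    exact ⟨a, by simp [h]⟩)

@[simp] theorem Germ.post_mk {X : ProObject.{w', w} C} {c d : C} (g : c ⟶ d) (i : X.J)
    (f : X.diagram.obj i ⟶ c) : (Germ.mk i f).post g = Germ.mk i (f ≫ g) := rfl

@[simp] theorem Germ.post_id {X : ProObject.{w', w} C} {c : C} (x : X.Germ c) :
    x.post (𝟙 c) = x := by
  obtain ⟨⟨i, f⟩⟩ := x
  exact congrArg (Germ.mk i) (Category.comp_id f)

@[simp] theorem Germ.post_post {X : ProObject.{w', w} C} {c d e : C} (g : c ⟶ d) (h : d ⟶ e)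
    (x : X.Germ c) : (x.post g).post h = x.post (g ≫ h) := by
  obtain ⟨⟨i, f⟩⟩ := x
  exact congrArg (Germ.mk i) (Category.assoc f g h)

/-- Morphisms of pro-objects: `Hom(X, Y) = lim_j colim_i Hom(X_i, Y_j)`. -/
@[ext]
structure Hom (X Y : ProObject.{w', w} C) where
  /-- The components in `colim_i Hom(X_i, Y_j)`. -/
  app (j : Y.J) : X.Germ (Y.diagram.obj j)
  compat {j j' : Y.J} (a : j ⟶ j') : (app j).post (Y.diagram.map a) = app j'

/-- The map `colim_j Hom(Y_j, c) → colim_i Hom(X_i, c)` induced by a morphism `X ⟶ Y`. -/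
def Hom.pre {X Y : ProObject.{w', w} C} (φ : Hom X Y) {c : C} : Y.Germ c → X.Germ c :=
  Quot.lift (fun p => (φ.app p.1).post p.2) (by
    rintro ⟨i, f⟩ ⟨j, f'⟩ ⟨a, h⟩
    dsimp only at h ⊢
    rw [h, ← Germ.post_post, φ.compat])

@[simp] theorem Hom.pre_mk {X Y : ProObject.{w', w} C} (φ : Hom X Y) {c : C} (j : Y.J)
    (f : Y.diagram.obj j ⟶ c) : φ.pre (Germ.mk j f) = (φ.app j).post f := rfl

theorem Hom.pre_post {X Y : ProObject.{w', w} C} (φ : Hom X Y) {c d : C} (g : c ⟶ d)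
    (y : Y.Germ c) : φ.pre (y.post g) = (φ.pre y).post g := by
  obtain ⟨⟨j, f⟩⟩ := y
  exact (Germ.post_post f g (φ.app j)).symm

/-- The identity of a pro-object. -/
def Hom.id (X : ProObject.{w', w} C) : Hom X X where
  app j := Germ.mk j (𝟙 _)
  compat {j j'} a := by
    rw [Germ.post_mk, Category.id_comp, ← Germ.mk_map a (𝟙 _), Category.comp_id]

/-- Composition of morphisms of pro-objects. -/
def Hom.comp {X Y Z : ProObject.{w', w} C} (φ : Hom X Y) (ψ : Hom Y Z) : Hom X Z where
  app k := φ.pre (ψ.app k)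
  compat a := by rw [← Hom.pre_post, ψ.compat]

theorem Hom.pre_id {X : ProObject.{w', w} C} {c : C} (x : X.Germ c) : (Hom.id X).pre x = x := by
  obtain ⟨⟨i, f⟩⟩ := x
  exact congrArg (Germ.mk i) (Category.id_comp f)

theorem Hom.pre_comp {X Y Z : ProObject.{w', w} C} (φ : Hom X Y) (ψ : Hom Y Z) {c : C}
    (z : Z.Germ c) : (φ.comp ψ).pre z = φ.pre (ψ.pre z) := by
  obtain ⟨⟨k, f⟩⟩ := z
  exact (Hom.pre_post φ f (ψ.app k)).symm

instance : Category (ProObject.{w', w} C) where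
  Hom := Hom
  id := Hom.id
  comp := Hom.comp
  id_comp φ := Hom.ext (funext fun j => Hom.pre_id (φ.app j))
  comp_id φ := Hom.ext (funext fun j => Germ.post_id (φ.app j))
  assoc φ ψ χ := Hom.ext (funext fun l => Hom.pre_comp φ ψ (χ.app l))

/-- An object of `C`, viewed as a pro-object indexed by the category with one morphism. -/
def const (c : C) : ProObject.{w', w} C where
  J := ULiftHom.{w'} (ULift.{w} (Discrete PUnit.{1}))
  diagram := (Functor.const _).obj c

/-- The canonical projection of a pro-object to its value at the index `i`. -/
def proj (X : ProObject.{w', w} C) (i : X.J) : X ⟶ const (X.diagram.obj i) :=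
  Hom.mk (fun _ => Germ.mk i (𝟙 _)) (fun _ => Germ.post_id _)

end ProObject

end ProObjects

/-! ### The pro-étale homotopy type -/

/-- The space of connected components, with the quotient topology, as a functor. -/
def spaceOfComponents : TopCat.{u} ⥤ TopCat.{u} where
  obj X := TopCat.of (ConnectedComponents X)
  map f := TopCat.ofHom
    ⟨f.hom.continuous.connectedComponentsMap, f.hom.continuous.connectedComponentsMap_continuous⟩
  map_id X := by
    ext x
    obtain ⟨x, rfl⟩ := ConnectedComponents.surjective_coe x
    rfl
  map_comp f g := by
    ext x
    obtain ⟨x, rfl⟩ := ConnectedComponents.surjective_coe x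
    rfl

section Scheme

variable (S : Scheme.{u})

/-- The underlying topological space of an object of the pro-étale site. -/
noncomputable def underlyingSpace : S.ProEt ⥤ TopCat.{u} :=
  Scheme.ProEt.forget S ⋙ Over.forget S ⋙ Scheme.forgetToTop

/-- The space of components of an object of the pro-étale site. -/
noncomputable def components : S.ProEt ⥤ TopCat.{u} :=
  underlyingSpace S ⋙ spaceOfComponents

/-- The category of hypercoverings of `S` in its pro-étale site, as a full subcategory of the
simplicial objects. -/
def hypercoverings : ObjectProperty (SimplicialObject S.ProEt) :=
  IsHypercovering (Scheme.ProEt.precoverage S)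

/-- The homotopy category of hypercoverings of `S`. -/
abbrev HoHy : Type (u + 1) := HoOn (hypercoverings S)

variable {S} in
/-- A hypercovering, as an object of the homotopy category. -/
abbrev HoHy.of (U : SimplicialObject S.ProEt)
    (hU : IsHypercovering (Scheme.ProEt.precoverage S) U) : HoHy S :=
  (CategoryTheory.Quotient.functor (homotopyRelOn (hypercoverings S))).obj ⟨U, hU⟩

/-- The pro-étale homotopy type of `S`: the pro-object `U ↦ π(U)` in the homotopy category of
simplicial spaces, indexed by the homotopy category of hypercoverings (which is cofiltered). -/
noncomputable def proEtaleHomotopyType [IsCofiltered (HoHy S)] :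
    ProObject.{u, u + 1} (Ho TopCat.{u}) where
  J := HoHy S
  diagram := HoOn.map (hypercoverings S) (components S)

variable {S} in
/-- An object `W` of the pro-étale site is weakly contractible if evaluation at `W` sends
surjections of sheaves of sets to surjections of sets. -/
def IsWeaklyContractible (W : S.ProEt) : Prop :=
  ∀ (F G : Sheaf (Scheme.ProEt.topology S) (Type (u + 1))) (φ : F ⟶ G),
    Sheaf.IsLocallySurjective φ → Function.Surjective (φ.hom.app (op W))

end Scheme

/-! ### The real numbers -/

/-- The classifying space of a discrete group as a simplicial (discrete) space: the nerve of the
group, viewed as a category with one object. -/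
def classifyingSpace (G : Type) [Group G] : SimplicialObject TopCat.{0} :=
  ((SimplicialObject.whiskering (Type) TopCat.{0}).obj TopCat.discrete).obj (nerve (SingleObj G))

/-- `Spec ℝ`. -/
noncomputable abbrev specReal : Scheme.{0} := Spec (CommRingCat.of ℝ)

/-- The natural morphism `Spec ℂ ⟶ Spec ℝ`. -/
noncomputable abbrev specComplexToSpecReal : Spec (CommRingCat.of ℂ) ⟶ specReal :=
  Spec.map (CommRingCat.ofHom (algebraMap ℝ ℂ))

instance : WeaklyEtale specComplexToSpecReal := by
  have : Etale specComplexToSpecReal := by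
    rw [HasRingHomProperty.Spec_iff (P := @Etale)]
    change (algebraMap ℝ ℂ).Etale
    rw [RingHom.etale_algebraMap]
    have : Algebra.FormallyEtale ℝ ℂ := Algebra.FormallyEtale.of_isSeparable ℝ ℂ
    exact ⟨inferInstance, Algebra.FinitePresentation.of_finiteType.mp inferInstance⟩
  infer_instance

/-- `Spec ℂ` as an object of the pro-étale site of `Spec ℝ`. -/
noncomputable def specComplex : specReal.ProEt := Scheme.ProEt.mk specComplexToSpecReal

end ProEtaleHomotopy

open ProEtaleHomotopy

/-!
Let `G = Gal(ℂ/ℝ)`. The theorem reduces to equivariant homotopy theory of simplicial `G`-sets, by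
taking `ℂ`-points.

An object of the pro-étale site of `Spec ℝ` is called split here if it is a finite coproduct of
copies of `Spec ℂ`. As `ℂ ⊗ ℂ ≅ ℂ × ℂ`, products of split objects with `Spec ℂ` are split
(`IsSplit.of_isLimit`), so `cosk₀(Spec ℂ)` is split in each degree. The group `G` acts freely on the
`ℂ`-points of a split object `V`, and morphisms from `V` to any object `Z` of the site are the same
as `G`-equivariant maps on `ℂ`-points (`IsSplit.exists_hom`, `IsSplit.hom_ext`).

Weakly étale schemes over an algebraically closed field have sections as soon as they are nonempty
(`exists_section_of_weaklyEtale`): a field extension `K` of `k` with `K ⊗ K → K` flat is algebraic.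
Hence `ℂ`-points lift along coverings (`exists_lift_of_mem_precoverage`). This has two consequences.
Split objects are weakly contractible, as the copies of `Spec ℂ` are disjoint; and for a
hypercovering `U` all maps from `∂Δ[n]` to the simplicial set of `ℂ`-points of `U` extend to `Δ[n]`
(`IsHypercovering.exists_points_lift`), as a map from `∂Δ[n + 1]` is a `ℂ`-point of the coskeleton
in degree `n + 1`.

Equivariant maps from a free simplicial `G`-set to a simplicial `G`-set `X` with this extension
property exist and are unique up to equivariant homotopy, because `(B × X)/G → B/G` is a trivial
fibration for free `B` (`exists_equivariant_extension`). So there is exactly one morphism from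
`cosk₀(Spec ℂ)` to each hypercovering in the homotopy category: it is an initial object
(`nonempty_isInitial_of_isSplit`). This implies that the homotopy category is cofiltered, that the
inclusion of this object is an initial functor, and that the projection to its value is an
isomorphism of pro-objects (`ProObject.isIso_proj`).

Finally, the points of a split object are the `G`-orbits of its `ℂ`-points, and its space is
discrete. In degree `n` the `ℂ`-points of `cosk₀(Spec ℂ)` are the `(n + 1)`-tuples of elements of
`G`, and dividing by the diagonal action gives the nerve of `G`
(`nonempty_underlyingSpace_cosk₀_iso`). The splitting of `cosk₀(Spec ℂ)` consists of the summands
given by the nondegenerate `ℂ`-points, which form `G`-stable sets (`nonempty_splitting_of_isSplit`).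
-/

namespace ProEtaleHomotopy

/-! ### Equivariant extensions along free simplicial actions -/

section EquivariantExtension

open MonoidalCategory

universe t

variable {G : Type} [Group G]

/-- The action of `G` on the simplices of a simplicial `G`-set. -/
instance simplicesMulAction (B : Action SSet.{t} G) (n : SimplexCategoryᵒᵖ) :
    MulAction G (B.V.obj n) where
  smul g x := NatTrans.app (B.ρ g : B.V ⟶ B.V) n x
  one_smul x := by
    change NatTrans.app (B.ρ 1 : B.V ⟶ B.V) n x = x
    rw [map_one]
    rfl
  mul_smul g h x := by
    change NatTrans.app (B.ρ (g * h) : B.V ⟶ B.V) n x = _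
    rw [map_mul]
    rfl

theorem map_smul_simplex (B : Action SSet.{t} G) {m n : SimplexCategoryᵒᵖ} (f : m ⟶ n) (g : G)
    (x : B.V.obj m) : B.V.map f (g • x) = g • B.V.map f x :=
  (NatTrans.naturality_apply (B.ρ g : B.V ⟶ B.V) f x).symm

theorem hom_app_smul {B X : Action SSet.{t} G} (φ : B ⟶ X) {n : SimplexCategoryᵒᵖ} (g : G)
    (x : B.V.obj n) : φ.hom.app n (g • x) = g • φ.hom.app n x :=
  ConcreteCategory.congr_hom (congrArg (fun ψ => NatTrans.app ψ n) (φ.comm g)) x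

/-- A map of simplicial sets which commutes with the action on simplices, as a map of simplicial
`G`-sets. -/
def equivariantMap {B X : Action SSet.{t} G} (φ : B.V ⟶ X.V)
    (h : ∀ (g : G) (n : SimplexCategoryᵒᵖ) (x : B.V.obj n), φ.app n (g • x) = g • φ.app n x) :
    B ⟶ X where
  hom := φ
  comm g := by
    ext n x
    exact h g n x

/-- The simplicial set of orbits of a simplicial `G`-set. -/
def orbits (B : Action SSet.{t} G) : SSet.{t} where
  obj n := MulAction.orbitRel.Quotient G (B.V.obj n)
  map f := ↾(Quotient.map' (B.V.map f) (by
    rintro _ y ⟨g, rfl⟩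
    exact ⟨g, (map_smul_simplex B f g y).symm⟩))
  map_id n := by
    ext x
    obtain ⟨x, rfl⟩ := Quotient.exists_rep x
    exact congrArg (Quotient.mk _) (B.V.map_id_apply _ x)
  map_comp f g := by
    ext x
    obtain ⟨x, rfl⟩ := Quotient.exists_rep x
    exact congrArg (Quotient.mk _) (B.V.map_comp_apply f g x)

/-- The orbit of a simplex. -/
def orbitOf (B : Action SSet.{t} G) : B.V ⟶ orbits B where
  app _ := ↾(Quotient.mk _)
  naturality _ _ _ := rfl

/-- A map of simplicial `G`-sets induces a map between the simplicial sets of orbits. -/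
def orbitsMap {B X : Action SSet.{t} G} (φ : B ⟶ X) : orbits B ⟶ orbits X where
  app n := ↾(Quotient.map' (φ.hom.app n) (by
    rintro _ y ⟨g, rfl⟩
    exact ⟨g, (hom_app_smul φ g y).symm⟩))
  naturality m n f := by
    ext x
    obtain ⟨x, rfl⟩ := Quotient.exists_rep x
    exact congrArg (Quotient.mk _) (NatTrans.naturality_apply φ.hom f x)

theorem orbitOf_surjective (B : Action SSet.{t} G) (n : SimplexCategoryᵒᵖ) :
    Function.Surjective ((orbitOf B).app n) := Quotient.exists_rep

theorem orbitOf_eq_iff (B : Action SSet.{t} G) {n : SimplexCategoryᵒᵖ} (x y : B.V.obj n) :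
    (orbitOf B).app n x = (orbitOf B).app n y ↔ ∃ g : G, g • y = x :=
  Quotient.eq''

/-- The projection `(B × X)/G → B/G`. -/
def borelProjection (B X : Action SSet.{t} G) : orbits (B ⊗ X) ⟶ orbits B :=
  orbitsMap (equivariantMap (B := B ⊗ X) (CartesianMonoidalCategory.fst B.V X.V)
    (fun _ _ _ => rfl))

/-- A pair of simplices `(b, x)` of `B × X`, as a simplex of the product. -/
def pairSimplex (B X : Action SSet.{t} G) {n : SimplexCategoryᵒᵖ} (b : B.V.obj n) (x : X.V.obj n) :
    (B ⊗ X).V.obj n := (b, x)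

theorem smul_pairSimplex (B X : Action SSet.{t} G) {n : SimplexCategoryᵒᵖ} (g : G) (b : B.V.obj n)
    (x : X.V.obj n) : g • pairSimplex B X b x = pairSimplex B X (g • b) (g • x) := rfl

theorem map_pairSimplex (B X : Action SSet.{t} G) {m n : SimplexCategoryᵒᵖ} (f : m ⟶ n)
    (b : B.V.obj m) (x : X.V.obj m) :
    (B ⊗ X).V.map f (pairSimplex B X b x) = pairSimplex B X (B.V.map f b) (X.V.map f x) := rfl

/-- If `G` acts freely on `B`, then a simplex of `(B × X)/G` over the orbit of `b` has a unique
representative of the form `(b, x)`. -/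
theorem existsUnique_pairSimplex {B : Action SSet.{t} G} (X : Action SSet.{t} G)
    (hB : ∀ (n : SimplexCategoryᵒᵖ) (b : B.V.obj n) (g : G), g • b = b → g = 1)
    {n : SimplexCategoryᵒᵖ} (e : (orbits (B ⊗ X)).obj n) (b : B.V.obj n)
    (h : (borelProjection B X).app n e = (orbitOf B).app n b) :
    ∃! x : X.V.obj n, (orbitOf (B ⊗ X)).app n (pairSimplex B X b x) = e := by
  obtain ⟨⟨b', x⟩, rfl⟩ := orbitOf_surjective _ _ e
  obtain ⟨g, rfl⟩ := (orbitOf_eq_iff B b' b).1 h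
  refine ⟨g⁻¹ • x, (orbitOf_eq_iff _ _ _).2 ⟨g⁻¹, ?_⟩, fun y hy => ?_⟩
  · change g⁻¹ • pairSimplex B X (g • b) x = _
    rw [smul_pairSimplex, inv_smul_smul]
  · obtain ⟨k, hk⟩ := (orbitOf_eq_iff _ _ _).1 hy
    change k • pairSimplex B X (g • b) x = _ at hk
    rw [smul_pairSimplex] at hk
    have h₁ : k • g • b = b := congrArg Prod.fst hk
    have h₂ : k • x = y := congrArg Prod.snd hk
    rw [← mul_smul] at h₁
    rw [← h₂, eq_inv_of_mul_eq_one_left (hB _ _ _ h₁)]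

/-- A lift to `B` of the image of a map `Z → (B × X)/G` in `B/G` is the first component of a lift
of this map to `B × X`, if `G` acts freely on `B`. -/
theorem exists_lift_pairSimplex {B : Action SSet.{t} G} (X : Action SSet.{t} G)
    (hB : ∀ (n : SimplexCategoryᵒᵖ) (b : B.V.obj n) (g : G), g • b = b → g = 1)
    {Z : SSet.{t}} (c : Z ⟶ orbits (B ⊗ X)) (β : Z ⟶ B.V)
    (h : c ≫ borelProjection B X = β ≫ orbitOf B) :
    ∃ ξ : Z ⟶ X.V, ∀ (n : SimplexCategoryᵒᵖ) (z : Z.obj n),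
      (orbitOf (B ⊗ X)).app n (pairSimplex B X (β.app n z) (ξ.app n z)) = c.app n z := by
  have key (n : SimplexCategoryᵒᵖ) (z : Z.obj n) := existsUnique_pairSimplex X hB
    (c.app n z) (β.app n z) (ConcreteCategory.congr_hom (congrArg (fun ψ => NatTrans.app ψ n) h) z)
  choose ξ hξ hξ' using key
  refine ⟨⟨fun n => ↾(ξ n), fun m n f => ?_⟩, hξ⟩
  ext z
  refine (hξ' n (Z.map f z) _ ?_).symm
  dsimp only
  rw [NatTrans.naturality_apply, NatTrans.naturality_apply]
  have := congrArg ((orbits (B ⊗ X)).map f) (hξ m z)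
  rw [← NatTrans.naturality_apply, map_pairSimplex] at this
  exact this

/-- If `G` acts freely on `B` and all maps `∂Δ[n] → X` extend to `Δ[n]`, then `(B × X)/G → B/G` is
a trivial fibration. -/
theorem borelProjection_rlp {B : Action SSet.{t} G} (X : Action SSet.{t} G)
    (hB : ∀ (n : SimplexCategoryᵒᵖ) (b : B.V.obj n) (g : G), g • b = b → g = 1)
    (hX : ∀ (n : ℕ) (f : (∂Δ[n] : SSet.{t}) ⟶ X.V), ∃ h : Δ[n] ⟶ X.V, ∂Δ[n].ι ≫ h = f) :
    (MorphismProperty.monomorphisms SSet.{t}).rlp (borelProjection B X) := by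
  rw [SSet.rlp_monomorphisms]
  suffices ∀ n : ℕ, HasLiftingProperty ∂Δ[n].ι (borelProjection B X) by
    rintro _ _ _ ⟨n⟩
    exact this n
  intro n
  refine ⟨fun {c q} sq => ?_⟩
  obtain ⟨b, hb⟩ := orbitOf_surjective B _ (SSet.yonedaEquiv q)
  have hq : SSet.yonedaEquiv.symm b ≫ orbitOf B = q := by
    apply SSet.yonedaEquiv.injective
    rw [SSet.yonedaEquiv_comp, Equiv.apply_symm_apply, hb]
  obtain ⟨ξ, hξ⟩ := exists_lift_pairSimplex X hB c (∂Δ[n].ι ≫ SSet.yonedaEquiv.symm b)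
    (by rw [sq.w, Category.assoc, hq])
  obtain ⟨x, hx⟩ := hX n ξ
  let l : Δ[n] ⟶ (B ⊗ X).V := CartesianMonoidalCategory.lift (SSet.yonedaEquiv.symm b) x
  refine ⟨⟨⟨l ≫ orbitOf _, ?_, ?_⟩⟩⟩
  · ext k z
    refine Eq.trans ?_ (hξ k z)
    subst hx
    rfl
  · rw [← hq]
    rfl

/-- The extension theorem for simplicial `G`-sets: an equivariant map from a simplicial `G`-subset
of a free simplicial `G`-set `B` to `X` extends to `B` if `X` is (nonequivariantly) a contractible
Kan complex. Equivariant maps `B → X` are sections of the trivial fibration `(B × X)/G → B/G`. -/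
theorem exists_equivariant_extension {A B X : Action SSet.{t} G} (i : A ⟶ B)
    (hi : ∀ n, Function.Injective (i.hom.app n))
    (hB : ∀ (n : SimplexCategoryᵒᵖ) (b : B.V.obj n) (g : G), g • b = b → g = 1)
    (hX : ∀ (n : ℕ) (f : (∂Δ[n] : SSet.{t}) ⟶ X.V), ∃ h : Δ[n] ⟶ X.V, ∂Δ[n].ι ≫ h = f)
    (f : A ⟶ X) : ∃ h : B ⟶ X, i ≫ h = f := by
  let l : A ⟶ B ⊗ X := equivariantMap (CartesianMonoidalCategory.lift i.hom f.hom) (by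
    intro g n x
    exact Prod.ext (hom_app_smul i g x) (hom_app_smul f g x))
  have hmono : Mono (orbitsMap i) := by
    have (n : SimplexCategoryᵒᵖ) : Mono ((orbitsMap i).app n) := by
      rw [mono_iff_injective]
      intro a a' h
      obtain ⟨a, rfl⟩ := orbitOf_surjective _ _ a
      obtain ⟨a', rfl⟩ := orbitOf_surjective _ _ a'
      obtain ⟨g, hg⟩ := (orbitOf_eq_iff B (i.hom.app n a) (i.hom.app n a')).1 h
      refine (orbitOf_eq_iff _ _ _).2 ⟨g, hi n ?_⟩
      rw [hom_app_smul, hg]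
    exact NatTrans.mono_of_mono_app _
  have sq : CommSq (orbitsMap l) (orbitsMap i) (borelProjection B X) (𝟙 _) := ⟨by
    ext n a
    obtain ⟨a, rfl⟩ := orbitOf_surjective _ _ a
    rfl⟩
  have := borelProjection_rlp X hB hX (orbitsMap i) hmono
  have hs := sq.fac_right
  have hs' := sq.fac_left
  generalize sq.lift = s at hs hs'
  obtain ⟨ξ, hξ⟩ := exists_lift_pairSimplex X hB (orbitOf B ≫ s) (𝟙 _)
    (by rw [Category.assoc, hs, Category.comp_id, Category.id_comp])
  have huniq {n : SimplexCategoryᵒᵖ} (b : B.V.obj n) (x : X.V.obj n)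
      (hx : (orbitOf (B ⊗ X)).app n (pairSimplex B X b x) = s.app n ((orbitOf B).app n b)) :
      ξ.app n b = x :=
    (existsUnique_pairSimplex X hB (s.app n ((orbitOf B).app n b)) b
      (ConcreteCategory.congr_hom (congrArg (fun ψ => NatTrans.app ψ n) hs) _)).unique
      (hξ n b) hx
  refine ⟨equivariantMap ξ fun g n b => huniq _ _ ?_, ?_⟩
  · rw [← smul_pairSimplex, (orbitOf_eq_iff _ _ _).2 ⟨g, rfl⟩,
      (orbitOf_eq_iff B (g • b) b).2 ⟨g, rfl⟩]
    exact hξ n b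
  · ext n a
    refine huniq _ _ ?_
    have := ConcreteCategory.congr_hom (congrArg (fun ψ => NatTrans.app ψ n) hs')
      ((orbitOf A).app n a)
    exact this.symm

end EquivariantExtension

/-! ### Equivariant homotopies -/

section EquivariantHomotopy

open MonoidalCategory

variable {G : Type} [Group G]

/-- The simplicial `G`-set `B ⨿ B`. -/
def twoCopies (B : Action SSet.{0} G) : Action SSet.{0} G where
  V :=
    { obj n := B.V.obj n × Bool
      map f := ↾(Prod.map (B.V.map f) id)
      map_id n := by
        ext x
        · exact B.V.map_id_apply _ x.1
        · rfl
      map_comp f g := by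
        ext x
        · exact B.V.map_comp_apply f g x.1
        · rfl }
  ρ :=
    { toFun g :=
        { app n := ↾(fun x : B.V.obj n × Bool => (g • x.1, x.2))
          naturality _ _ f := by
            ext x
            · exact (map_smul_simplex B f g x.1).symm
            · rfl }
      map_one' := by
        refine SSet.hom_ext fun n => ?_
        ext x
        · exact one_smul G x.1
        · rfl
      map_mul' g h := by
        refine SSet.hom_ext fun n => ?_
        ext x
        · exact mul_smul g h x.1
        · rfl }

/-- The cylinder `B × Δ[1]`, with the trivial action on `Δ[1]`. -/
noncomputable abbrev cylinder (B : Action SSet.{0} G) : Action SSet.{0} G :=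
  B ⊗ Action.trivial G Δ[1]

/-- The inclusion of the two ends of the cylinder. -/
noncomputable def cylinderEnds (B : Action SSet.{0} G) : twoCopies B ⟶ cylinder B :=
  equivariantMap
    { app n := ↾(fun x : B.V.obj n × Bool =>
        if x.2 then NatTrans.app (SSet.ι₁ : B.V ⟶ _) n x.1 else
          NatTrans.app (SSet.ι₀ : B.V ⟶ _) n x.1)
      naturality m n f := by
        ext ⟨x, _ | _⟩
        · exact NatTrans.naturality_apply (SSet.ι₀ : B.V ⟶ _) f x
        · exact NatTrans.naturality_apply (SSet.ι₁ : B.V ⟶ _) f x }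
    (by rintro g n ⟨x, _ | _⟩ <;> rfl)

theorem cylinderEnds_injective (B : Action SSet.{0} G) (n : SimplexCategoryᵒᵖ) :
    Function.Injective ((cylinderEnds B).hom.app n) := by
  have h01 (x y : B.V.obj n) (h : NatTrans.app (SSet.ι₀ : B.V ⟶ _) n x =
      NatTrans.app (SSet.ι₁ : B.V ⟶ _) n y) : False := by
    obtain ⟨⟨n⟩⟩ := n
    have h' := congrArg Prod.snd h
    have : (0 : Fin 2) = 1 :=
      congrArg (fun s : (Δ[1] : SSet.{0}).obj (op ⦋n⦌) => s (0 : Fin (n + 1))) h'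
    simp at this
  rintro ⟨x, _ | _⟩ ⟨y, _ | _⟩ h
  · exact congrArg (fun z : (cylinder B).V.obj n => (z.1, false)) h
  · exact (h01 _ _ h).elim
  · exact (h01 _ _ h.symm).elim
  · exact congrArg (fun z : (cylinder B).V.obj n => (z.1, true)) h

/-- Two equivariant maps from a free simplicial `G`-set to a simplicial `G`-set whose underlying
simplicial set is a contractible Kan complex are related by an equivariant simplicial homotopy. -/
theorem exists_equivariant_homotopy {B X : Action SSet.{0} G}
    (hB : ∀ (n : SimplexCategoryᵒᵖ) (b : B.V.obj n) (g : G), g • b = b → g = 1)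
    (hX : ∀ (n : ℕ) (f : (∂Δ[n] : SSet.{0}) ⟶ X.V), ∃ h : Δ[n] ⟶ X.V, ∂Δ[n].ι ≫ h = f)
    (f g : B ⟶ X) :
    ∃ H : SimplicialObject.Homotopy (X := B.V) (Y := X.V) f.hom g.hom,
      ∀ (n : ℕ) (i : Fin (n + 1)) (k : G) (x : B.V.obj (op ⦋n⦌)),
        H.h i (k • x) = k • (show X.V.obj (op ⦋n + 1⦌) from H.h i x) := by
  obtain ⟨h, hh⟩ := exists_equivariant_extension (cylinderEnds B) (cylinderEnds_injective B)
    (fun n b k hk => hB n b.1 k (congrArg Prod.fst hk)) hX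
    (equivariantMap (B := twoCopies B) (X := X)
      { app n := ↾(fun x : B.V.obj n × Bool => if x.2 then g.hom.app n x.1 else f.hom.app n x.1)
        naturality m n a := by
          ext ⟨x, _ | _⟩
          · exact NatTrans.naturality_apply f.hom a x
          · exact NatTrans.naturality_apply g.hom a x }
      (by
        rintro k n ⟨x, _ | _⟩
        · exact hom_app_smul f k x
        · exact hom_app_smul g k x))
  have hh' (n : SimplexCategoryᵒᵖ) (x : B.V.obj n × Bool) := ConcreteCategory.congr_hom
    (congrArg (fun φ : twoCopies B ⟶ X => NatTrans.app φ.hom n) hh) x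
  let K : SSet.Homotopy f.hom g.hom :=
    { h := h.hom
      h₀ := by
        ext n x
        exact hh' n (x, false)
      h₁ := by
        ext n x
        exact hh' n (x, true)
      rel := by
        ext n ⟨⟨x, hx⟩, y⟩
        exact hx.elim }
  refine ⟨K.toSimplicialObjectHomotopy, fun n i k x => ?_⟩
  -- the combinatorial homotopy evaluates `h` at the nondegenerate simplices of the prism over `x`
  have e : SSet.yonedaEquiv.symm (k • x) = SSet.yonedaEquiv.symm x ≫ (B.ρ k : B.V ⟶ B.V) :=
    (SSet.yonedaEquiv_symm_comp x (B.ρ k : B.V ⟶ B.V)).symm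
  change NatTrans.app (SSet.yonedaEquiv.symm (k • x) ▷ Δ[1] ≫ h.hom) _ _ = k •
    (show X.V.obj (op ⦋n + 1⦌) from
      NatTrans.app (SSet.yonedaEquiv.symm x ▷ Δ[1] ≫ h.hom) _ _)
  rw [e]
  exact hom_app_smul h k (NatTrans.app (SSet.yonedaEquiv.symm x ▷ Δ[1]) (op ⦋n + 1⦌)
    (SSet.prodStdSimplex.nonDegenerateEquiv₁ i).1)

/-- The extension theorem, applied to the empty simplicial `G`-subset, gives the existence of
equivariant maps. -/
theorem nonempty_equivariantMap {B X : Action SSet.{0} G}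
    (hB : ∀ (n : SimplexCategoryᵒᵖ) (b : B.V.obj n) (g : G), g • b = b → g = 1)
    (hX : ∀ (n : ℕ) (f : (∂Δ[n] : SSet.{0}) ⟶ X.V), ∃ h : Δ[n] ⟶ X.V, ∂Δ[n].ι ≫ h = f) :
    Nonempty (B ⟶ X) := by
  let E : SSet.{0} := (Functor.const _).obj PEmpty
  obtain ⟨h, -⟩ := exists_equivariant_extension (A := Action.trivial G E) (B := B)
    (equivariantMap { app _ := ↾PEmpty.elim, naturality := by intros; ext ⟨⟩ } (by rintro _ _ ⟨⟩))
    (by rintro _ ⟨⟩) hB hX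
    (equivariantMap { app _ := ↾PEmpty.elim, naturality := by intros; ext ⟨⟩ } (by rintro _ _ ⟨⟩))
  exact ⟨h⟩

end EquivariantHomotopy

/-! ### Sections of weakly étale morphisms to algebraically closed fields -/

section WeaklyEtale

open TensorProduct

universe t

/-- If an element `w` of `A ⊗ K` is killed by `b ⊗ 1 - 1 ⊗ b` and nonzero, then `b` is integral: the
finite-dimensional space spanned by the left components of `w` is stable under `b`. -/
theorem isIntegral_of_tmul_one_mul_eq {k : Type*} {K : Type*} [Field k] [Field K] [Algebra k K]
    (b : K) (w : K ⊗[k] K) (hw : w ≠ 0) (h : (b ⊗ₜ[k] (1 : K)) * w = ((1 : K) ⊗ₜ[k] b) * w) :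
    IsIntegral k b := by
  classical
  let φ : Module.Dual k K →ₗ[k] K ⊗[k] K →ₗ[k] K :=
    { toFun f := (TensorProduct.rid k K).toLinearMap ∘ₗ f.lTensor K
      map_add' f g := by
        ext
        simp
      map_smul' c f := by
        ext
        simp }
  have hφ (f : Module.Dual k K) (x y : K) : φ f (x ⊗ₜ y) = f y • x := by simp [φ]
  have hφ_add (f : Module.Dual k K) (x y : K ⊗[k] K) : φ f (x + y) = φ f x + φ f y :=
    map_add _ _ _
  have hφ_zero (f : Module.Dual k K) : φ f 0 = 0 := map_zero _
  clear_value φ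
  let N : Submodule k K := LinearMap.range (φ.flip w)
  have hN : N ≠ ⊥ := by
    intro hN
    have hzero (f : Module.Dual k K) : φ f w = 0 := by
      have : φ.flip w f ∈ N := ⟨f, rfl⟩
      rwa [hN, Submodule.mem_bot] at this
    let B := Module.Basis.ofVectorSpace k K
    apply hw
    apply (Algebra.TensorProduct.basis K B).repr.injective
    ext i
    rw [map_zero, Finsupp.zero_apply, ← hzero (B.coord i)]
    clear h hzero hw hN N
    induction w with
    | zero => simp
    | tmul x y => simp [hφ, Algebra.smul_def, mul_comm]
    | add x y hx hy => simp [hx, hy]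
  have hfg : N.FG := by
    obtain ⟨S, rfl⟩ := TensorProduct.exists_finset w
    have hle : N ≤ Submodule.span k (S.image Prod.fst : Set K) := by
      rintro _ ⟨f, rfl⟩
      rw [LinearMap.flip_apply, map_sum]
      refine Submodule.sum_mem _ fun s hs => ?_
      rw [hφ]
      exact Submodule.smul_mem _ _ (Submodule.subset_span (Finset.mem_coe.2
        (Finset.mem_image_of_mem _ hs)))
    have : FiniteDimensional k (Submodule.span k (S.image Prod.fst : Set K)) :=
      FiniteDimensional.span_finset k _
    exact Module.Finite.iff_fg.1 (Submodule.finiteDimensional_of_le hle)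
  refine isIntegral_of_smul_mem_submodule N hN hfg b ?_
  rintro _ ⟨f, rfl⟩
  refine ⟨f ∘ₗ LinearMap.mulLeft k b, ?_⟩
  have h₁ (z : K ⊗[k] K) : φ f ((b ⊗ₜ[k] (1 : K)) * z) = b • φ f z := by
    induction z with
    | zero => simp
    | tmul x y => simp [hφ]
    | add x y hx hy => rw [mul_add, map_add, hx, hy, map_add, smul_add]
  have h₂ (z : K ⊗[k] K) : φ f (((1 : K) ⊗ₜ[k] b) * z) = φ (f ∘ₗ LinearMap.mulLeft k b) z := by
    induction z with
    | zero => simp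
    | tmul x y => simp [hφ]
    | add x y hx hy => rw [mul_add, map_add, hx, hy, map_add]
  rw [LinearMap.flip_apply, LinearMap.flip_apply, ← h₁, h, h₂]

/-- A field extension `K` of an algebraically closed field `k` such that `K ⊗ K → K` is flat is
trivial. By the equational criterion, flatness provides for each `b` an element `w` of `K ⊗ K` with
image `1` in `K` which is killed by `b ⊗ 1 - 1 ⊗ b`. -/
theorem bijective_algebraMap_of_flat_lmul {k K : Type*} [Field k] [IsAlgClosed k] [Field K]
    [Algebra k K] (h : (Algebra.TensorProduct.lmul' k (S := K)).toRingHom.Flat) :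
    Function.Bijective (algebraMap k K) := by
  have : Algebra.IsIntegral k K := ⟨fun b => by
    algebraize [(Algebra.TensorProduct.lmul' k (S := K)).toRingHom]
    have hmul (x : K ⊗[k] K) (y : K) : x • y = Algebra.TensorProduct.lmul' k (S := K) x * y := rfl
    obtain ⟨l, a, y, hy, ha⟩ := Module.Flat.isTrivialRelation_of_sum_smul_eq_zero
      (R := K ⊗[k] K) (M := K) (ι := Unit) (f := fun _ => b ⊗ₜ[k] (1 : K) - (1 : K) ⊗ₜ[k] b)
      (x := fun _ => 1) (by simp [hmul])
    let w : K ⊗[k] K := ∑ j, a () j * (y j ⊗ₜ[k] (1 : K))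
    refine isIntegral_of_tmul_one_mul_eq b w ?_ ?_
    · intro hw
      have h1 : (1 : K) = ∑ j, a () j • y j := hy ()
      have h2 : Algebra.TensorProduct.lmul' k (S := K) w = 1 := by
        refine Eq.trans ?_ h1.symm
        rw [map_sum]
        simp [hmul]
      rw [hw, map_zero] at h2
      exact zero_ne_one h2
    · rw [← sub_eq_zero, ← sub_mul, Finset.mul_sum]
      refine Finset.sum_eq_zero fun j _ => ?_
      have h3 := ha j
      simp only [Finset.univ_unique, Finset.sum_singleton] at h3
      rw [← mul_assoc, h3, zero_mul]⟩
  exact IsAlgClosed.algebraMap_bijective_of_isIntegral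

/-- A nonempty weakly étale scheme over an algebraically closed field `k` has a section, as the
residue fields of its points are equal to `k`. -/
theorem exists_section_of_weaklyEtale {k : Type t} [Field k] [IsAlgClosed k] {U : Scheme.{t}}
    (f : U ⟶ Spec (CommRingCat.of k)) [WeaklyEtale f] (u : U) :
    ∃ s : Spec (CommRingCat.of k) ⟶ U, s ≫ f = 𝟙 _ := by
  obtain ⟨φ, hφ⟩ := Spec.map_surjective (U.fromSpecResidueField u ≫ f)
  -- the morphism from the residue field inherits the flat diagonal, as it is a monomorphism
  -- followed by `f`
  have hdiag : Flat (pullback.diagonal (Spec.map φ)) := by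
    rw [hφ, pullback.diagonal_comp]
    infer_instance
  algebraize [φ.hom]
  have hφ' : φ = CommRingCat.ofHom (algebraMap k (U.residueField u)) := rfl
  rw [hφ', show pullback.diagonal _ = _ from diagonal_SpecMap k (U.residueField u)] at hdiag
  have hdiag' : Flat (Spec.map (CommRingCat.ofHom
      (Algebra.TensorProduct.lmul' k (S := U.residueField u)).toRingHom)) := by
    have := @Flat.comp _ _ _ _ (pullbackSpecIso k (U.residueField u) (U.residueField u)).hom hdiag
      inferInstance
    rwa [Category.assoc, Iso.inv_hom_id, Category.comp_id] at this
  rw [Flat.SpecMap_iff] at hdiag'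
  have hb : Function.Bijective (algebraMap k (U.residueField u)) :=
    bijective_algebraMap_of_flat_lmul hdiag'
  have : IsIso φ := (ConcreteCategory.isIso_iff_bijective φ).2 hb
  refine ⟨inv (Spec.map φ) ≫ U.fromSpecResidueField u, ?_⟩
  rw [Category.assoc, ← hφ, IsIso.inv_hom_id]

end WeaklyEtale

/-! ### The pro-étale site and geometric points -/

section Morphisms

universe t

variable {S : Scheme.{t}}

/-- The scheme underlying an object of the pro-étale site. -/
noncomputable abbrev underlyingScheme (S : Scheme.{t}) : S.ProEt ⥤ Scheme.{t} :=
  Scheme.ProEt.forget S ⋙ Over.forget S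

/-- The morphism of the pro-étale site given by a morphism of schemes over `S`. -/
def proEtHom {U V : S.ProEt} (f : U.left ⟶ V.left) (w : f ≫ V.hom = U.hom) : U ⟶ V :=
  (Scheme.ProEt.forgetFullyFaithful S).preimage (Over.homMk f w)

theorem proEt_hom_ext {U V : S.ProEt} {f g : U ⟶ V}
    (h : (underlyingScheme S).map f = (underlyingScheme S).map g) : f = g :=
  (Scheme.ProEt.forget S).map_injective (Over.OverMorphism.ext h)

theorem underlyingScheme_map_w {U V : S.ProEt} (f : U ⟶ V) :
    (underlyingScheme S).map f ≫ V.hom = U.hom :=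
  Over.w ((Scheme.ProEt.forget S).map f)

/-- An isomorphism of the pro-étale site given by an isomorphism of schemes over `S`. -/
def proEtIso {U V : S.ProEt} (e : U.left ≅ V.left) (w : e.hom ≫ V.hom = U.hom) : U ≅ V :=
  (Scheme.ProEt.forgetFullyFaithful S).preimageIso (Over.isoMk e w)

/-- The product of `U` and `V` in the pro-étale site, as a fiber product of schemes. -/
noncomputable def proEtProduct (U V : S.ProEt) : S.ProEt :=
  Scheme.ProEt.mk (pullback.fst U.hom V.hom ≫ U.hom)

/-- The projections of `proEtProduct U V`. -/
noncomputable def proEtProductFan (U V : S.ProEt) : BinaryFan U V :=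
  BinaryFan.mk (P := proEtProduct U V) (proEtHom (pullback.fst U.hom V.hom) rfl)
    (proEtHom (pullback.snd U.hom V.hom) pullback.condition.symm)

/-- The fiber product of schemes is the product in the pro-étale site. -/
noncomputable def proEtProductIsLimit (U V : S.ProEt) : IsLimit (proEtProductFan U V) :=
  BinaryFan.isLimitMk
    (fun s => proEtHom (U := s.pt) (V := proEtProduct U V)
      (pullback.lift ((underlyingScheme S).map s.fst) ((underlyingScheme S).map s.snd)
        ((underlyingScheme_map_w s.fst).trans (underlyingScheme_map_w s.snd).symm))
      ((pullback.lift_fst_assoc _ _ _ _).trans (underlyingScheme_map_w s.fst)))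
    (fun s => proEt_hom_ext (pullback.lift_fst _ _ _))
    (fun s => proEt_hom_ext (pullback.lift_snd _ _ _))
    (fun s m h₁ h₂ => proEt_hom_ext (by
      apply pullback.hom_ext
      · exact (congrArg (underlyingScheme S).map h₁).trans (pullback.lift_fst _ _ _).symm
      · exact (congrArg (underlyingScheme S).map h₂).trans (pullback.lift_snd _ _ _).symm))

/-- A surjective quasi-compact morphism of the pro-étale site is a covering. -/
theorem singleton_mem_precoverage {U V : S.ProEt} (f : U ⟶ V)
    [Surjective ((underlyingScheme S).map f)] [QuasiCompact ((underlyingScheme S).map f)] :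
    Presieve.singleton f ∈ Scheme.ProEt.precoverage S V := by
  have hf : WeaklyEtale ((underlyingScheme S).map f) := by
    have : WeaklyEtale ((underlyingScheme S).map f ≫ V.hom) := by
      rw [underlyingScheme_map_w]
      exact U.prop
    exact @WeaklyEtale.of_comp _ _ _ ((underlyingScheme S).map f) V.hom this V.prop
  change Presieve.map (underlyingScheme S) (Presieve.singleton f) ∈
    Scheme.proetalePrecoverage ((underlyingScheme S).obj V)
  rw [Presieve.map_singleton]
  exact Scheme.Hom.singleton_mem_propQCPrecoverage hf

end Morphisms

section Points

universe t

/-- Each morphism from the spectrum of an algebraically closed field to an object of the pro-étale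
site lifts along a member of a given covering family, as weakly étale schemes over this field have
sections. -/
theorem exists_lift_of_mem_precoverage {S : Scheme.{t}} {k : Type t} [Field k] [IsAlgClosed k]
    (p : Spec (CommRingCat.of k) ⟶ S) [WeaklyEtale p] {X : S.ProEt} {R : Presieve X}
    (hR : R ∈ Scheme.ProEt.precoverage S X) (y : Scheme.ProEt.mk p ⟶ X) :
    ∃ (Y : S.ProEt) (f : Y ⟶ X), R f ∧ ∃ s : Scheme.ProEt.mk p ⟶ Y, s ≫ f = y := by
  have hR' : Presieve.map (underlyingScheme S) R ∈
    Scheme.proetalePrecoverage ((underlyingScheme S).obj X) := hR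
  have h₂ := hR'.2.2
  let y' : Spec (CommRingCat.of k) ⟶ X.left := (underlyingScheme S).map y
  let pt : Spec (CommRingCat.of k) := (⊥ : PrimeSpectrum k)
  obtain ⟨_, _, ⟨hf⟩, v, hv⟩ := hR'.2.1 (y' pt)
  obtain @⟨Y, f, hf⟩ := hf
  let f' : Y.left ⟶ X.left := (underlyingScheme S).map f
  have : WeaklyEtale f' := h₂ ⟨hf⟩
  obtain ⟨u, -⟩ := Scheme.Pullback.exists_preimage_pullback (f := f') (g := y') v pt hv
  obtain ⟨s, hs⟩ := exists_section_of_weaklyEtale (pullback.snd f' y') u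
  have hs' : (s ≫ pullback.fst f' y') ≫ f' = y' := by
    rw [Category.assoc, pullback.condition, reassoc_of% hs]
  refine ⟨Y, f, hf, proEtHom (s ≫ pullback.fst f' y') ?_, proEt_hom_ext hs'⟩
  rw [← underlyingScheme_map_w f, ← underlyingScheme_map_w y]
  exact (Category.assoc _ _ _).symm.trans (congrArg (· ≫ X.hom) hs')

/-- Each morphism from the spectrum of an algebraically closed field to an object of the pro-étale
site belongs to all covering sieves. -/
theorem mem_of_mem_topology {S : Scheme.{t}} {k : Type t} [Field k] [IsAlgClosed k]
    (p : Spec (CommRingCat.of k) ⟶ S) [WeaklyEtale p] {X : S.ProEt} {R : Sieve X}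
    (hR : R ∈ Scheme.ProEt.topology S X) (y : Scheme.ProEt.mk p ⟶ X) : R y := by
  induction hR with
  | of X T hT =>
    obtain ⟨Y, f, hf, s, rfl⟩ := exists_lift_of_mem_precoverage p hT y
    exact ⟨Y, s, f, hf, rfl⟩
  | top => trivial
  | pullback X T _ Y f ih => exact ih (y ≫ f)
  | transitive X T R _ _ ih₁ ih₂ =>
    have := ih₂ (ih₁ y) (𝟙 _)
    rwa [Sieve.pullback_apply, Category.id_comp] at this

end Points

/-! ### Coproducts of copies of `Spec ℂ` -/

section SplitObjects

/-- The action of `Gal(ℂ/ℝ)` on `Spec ℂ`. By `galMap_mul`, composition with `galMap g` on the left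
is a left action of the group on the morphisms from `Spec ℂ` to any object. -/
noncomputable def galMap (g : ℂ ≃ₐ[ℝ] ℂ) : specComplex ⟶ specComplex :=
  proEtHom (Spec.map (CommRingCat.ofHom (g : ℂ →+* ℂ))) (by
    change Spec.map _ ≫ Spec.map _ = Spec.map _
    rw [← Spec.map_comp, ← CommRingCat.ofHom_comp]
    congr 2
    ext x
    exact g.commutes x)

theorem galMap_one : galMap 1 = 𝟙 specComplex :=
  proEt_hom_ext (Spec.map_id (CommRingCat.of ℂ))

theorem galMap_mul (g h : ℂ ≃ₐ[ℝ] ℂ) : galMap (g * h) = galMap g ≫ galMap h :=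
  proEt_hom_ext (Spec.map_comp (CommRingCat.ofHom (h : ℂ →+* ℂ)) (CommRingCat.ofHom (g : ℂ →+* ℂ)))

/-- The morphism from the spectrum of `ℂ ^ ι` to `Spec ℝ`. -/
noncomputable abbrev specPiToSpecReal (ι : Type) :
    Spec (CommRingCat.of (ι → ℂ)) ⟶ specReal :=
  Spec.map (CommRingCat.ofHom (algebraMap ℝ (ι → ℂ)))

instance weaklyEtale_specPiToSpecReal (ι : Type) [Finite ι] :
    WeaklyEtale (specPiToSpecReal ι) := by
  have : Etale (specPiToSpecReal ι) := by
    rw [HasRingHomProperty.Spec_iff (P := @Etale)]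
    change (algebraMap ℝ (ι → ℂ)).Etale
    rw [RingHom.etale_algebraMap]
    have : Algebra.FormallyEtale ℝ ℂ := Algebra.FormallyEtale.of_isSeparable ℝ ℂ
    have : Algebra.FormallyEtale ℝ (ι → ℂ) :=
      (Algebra.FormallyEtale.pi_iff (R := ℝ) (fun _ : ι => ℂ)).2 fun _ => this
    exact ⟨inferInstance, Algebra.FinitePresentation.of_finiteType.mp inferInstance⟩
  infer_instance

/-- The coproduct of copies of `Spec ℂ` indexed by a finite type, as an object of the pro-étale
site of `Spec ℝ`. -/
noncomputable def copies (ι : Type) [Finite ι] : specReal.ProEt :=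
  Scheme.ProEt.mk (specPiToSpecReal ι)

/-- The inclusions of the copies of `Spec ℂ`. -/
noncomputable def copiesInj {ι : Type} [Finite ι] (i : ι) : specComplex ⟶ copies ι :=
  proEtHom (Spec.map (CommRingCat.ofHom (Pi.evalRingHom (fun _ : ι => ℂ) i))) (by
    change Spec.map _ ≫ Spec.map _ = Spec.map _
    rw [← Spec.map_comp]
    rfl)

/-- The spectrum of a finite product of rings is the coproduct of the spectra. -/
noncomputable def specPiIsColimit {ι : Type} [Finite ι] (R : ι → CommRingCat.{0}) :
    IsColimit (Cofan.mk (Spec (CommRingCat.of (∀ i, R i)))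
      (fun i => Spec.map (CommRingCat.ofHom (Pi.evalRingHom (fun i => R i) i)))) :=
  IsColimit.ofIsoColimit (coproductIsCoproduct (fun i => Spec (R i)))
    (Cofan.ext (asIso (sigmaSpec R)) (fun i => ι_sigmaSpec R i))

/-- `copies ι` is the coproduct of the copies of `Spec ℂ`, in the pro-étale site. -/
noncomputable def copiesIsColimit (ι : Type) [Finite ι] :
    IsColimit (Cofan.mk (copies ι) (copiesInj (ι := ι))) := by
  let h := specPiIsColimit (fun _ : ι => CommRingCat.of ℂ)
  let d (Z : Scheme.{0}) (f : ι → (Spec (CommRingCat.of ℂ) ⟶ Z)) :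
      Spec (.of (ι → ℂ)) ⟶ Z := Cofan.IsColimit.desc h f
  have hd (Z : Scheme.{0}) (f : ι → (Spec (CommRingCat.of ℂ) ⟶ Z)) (i : ι) :
      Spec.map (CommRingCat.ofHom (Pi.evalRingHom (fun _ : ι => ℂ) i)) ≫ d Z f = f i :=
    Cofan.IsColimit.fac h f i
  have hext (Z : Scheme.{0}) (a b : Spec (.of (ι → ℂ)) ⟶ Z)
      (hab : ∀ i : ι, Spec.map (CommRingCat.ofHom (Pi.evalRingHom (fun _ : ι => ℂ) i)) ≫ a =
        Spec.map (CommRingCat.ofHom (Pi.evalRingHom (fun _ : ι => ℂ) i)) ≫ b) : a = b :=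
    Cofan.IsColimit.hom_ext h a b hab
  refine Cofan.IsColimit.mk _
    (fun s => proEtHom (U := copies ι) (V := s.pt)
      (d s.pt.left fun i => (underlyingScheme specReal).map (s.inj i)) ?_)
    (fun s i => proEt_hom_ext ?_) (fun s m hm => proEt_hom_ext ?_)
  · refine hext _ _ _ fun i => ?_
    exact (Category.assoc _ _ _).symm.trans ((congrArg (· ≫ s.pt.hom) (hd _ _ i)).trans
      ((underlyingScheme_map_w (s.inj i)).trans (underlyingScheme_map_w (copiesInj i)).symm))
  · exact hd _ _ i
  · refine hext _ _ _ fun i => ?_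
    exact ((underlyingScheme specReal).map_comp (copiesInj i) m).symm.trans
      ((congrArg (underlyingScheme specReal).map (hm i)).trans
        (hd s.pt.left (fun i => (underlyingScheme specReal).map (s.inj i)) i).symm)

/-- A homomorphism of `ℝ`-algebras `ℂ ^ ι → ℂ` is an evaluation followed by an element of the
Galois group. -/
theorem existsUnique_eval_of_algHom {ι : Type} [Finite ι] (φ : (ι → ℂ) →ₐ[ℝ] ℂ) :
    ∃! p : ι × (ℂ ≃ₐ[ℝ] ℂ), ∀ f : ι → ℂ, p.2 (f p.1) = φ f := by
  classical
  have := Fintype.ofFinite ι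
  obtain ⟨i, hi⟩ : ∃ i : ι, φ (Pi.single i 1) ≠ 0 := by
    by_contra! h
    have h1 : φ 1 = ∑ i, φ (Pi.single i 1) := by
      rw [← map_sum]
      congr 1
      exact (Finset.univ_sum_single (1 : ι → ℂ)).symm
    simp [h] at h1
  have hidem (j : ι) : φ (Pi.single j 1) * φ (Pi.single j 1) = φ (Pi.single j 1) := by
    rw [← map_mul, ← Pi.single_mul, one_mul]
  have hi1 : φ (Pi.single i 1) = 1 := by
    have := hidem i
    exact mul_left_cancel₀ hi (by rw [this, mul_one])
  have hφ (f : ι → ℂ) : φ f = φ (Pi.single i (f i)) := by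
    have : φ f * φ (Pi.single i 1) = φ (Pi.single i (f i)) := by
      rw [← map_mul]
      congr 1
      ext j
      by_cases h : j = i
      · subst h
        simp
      · simp [h]
    rwa [hi1, mul_one] at this
  let ψ : ℂ →ₐ[ℝ] ℂ := φ.comp (Algebra.algHom ℝ ℂ (ι → ℂ))
  have hψ (f : ι → ℂ) : φ f = ψ (f i) :=
    (hφ f).trans (hφ (Function.const ι (f i))).symm
  refine ⟨(i, AlgEquiv.ofBijective ψ (Algebra.IsAlgebraic.algHom_bijective ψ)),
    fun f => (hψ f).symm, ?_⟩
  rintro ⟨j, g⟩ hg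
  have hji : j = i := by
    by_contra hji
    have := hg (Pi.single i 1)
    rw [hi1] at this
    simp [hji] at this
  subst hji
  refine Prod.ext rfl (AlgEquiv.ext fun z => ?_)
  have h1 := hg (Function.const ι z)
  have h2 := hψ (Function.const ι z)
  exact h1.trans h2

/-- The `ℂ`-points of a coproduct of copies of `Spec ℂ`: a summand and an element of `G`. -/
theorem existsUnique_copiesInj {ι : Type} [Finite ι] (y : specComplex ⟶ copies ι) :
    ∃! p : ι × (ℂ ≃ₐ[ℝ] ℂ), galMap p.2 ≫ copiesInj p.1 = y := by
  obtain ⟨φ, hφ⟩ := Spec.map_surjective (R := CommRingCat.of (ι → ℂ)) (S := CommRingCat.of ℂ)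
    ((underlyingScheme specReal).map y)
  have hw : Spec.map φ ≫ specPiToSpecReal ι = specComplexToSpecReal := by
    rw [hφ]
    exact underlyingScheme_map_w y
  rw [← Spec.map_comp] at hw
  let φ' : (ι → ℂ) →ₐ[ℝ] ℂ :=
    { φ.hom with
      commutes' r := ConcreteCategory.congr_hom (Spec.map_injective hw) r }
  have key (p : ι × (ℂ ≃ₐ[ℝ] ℂ)) :
      galMap p.2 ≫ copiesInj p.1 = y ↔ ∀ f : ι → ℂ, p.2 (f p.1) = φ' f := by
    have : galMap p.2 ≫ copiesInj p.1 = y ↔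
        CommRingCat.ofHom (Pi.evalRingHom (fun _ : ι => ℂ) p.1) ≫
          CommRingCat.ofHom (p.2 : ℂ →+* ℂ) = φ := by
      refine ⟨fun h => Spec.map_injective ?_, fun h => proEt_hom_ext (Eq.trans ?_ hφ)⟩
      · rw [hφ, Spec.map_comp, ← h]
        rfl
      · rw [← h, Spec.map_comp]
        rfl
    rw [this]
    refine ⟨fun h f => ?_, fun h => ?_⟩
    · exact ConcreteCategory.congr_hom h f
    · ext f
      exact h f
  obtain ⟨p, hp, hp'⟩ := existsUnique_eval_of_algHom φ'
  exact ⟨p, (key p).2 hp, fun q hq => hp' q ((key q).1 hq)⟩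

/-- An object of the pro-étale site of `Spec ℝ` is split if it is a finite coproduct of copies of
`Spec ℂ`. -/
def IsSplit (V : specReal.ProEt) : Prop :=
  ∃ (ι : Type) (_ : Finite ι), Nonempty (copies ι ≅ V)

theorem IsSplit.of_iso {V W : specReal.ProEt} (hV : IsSplit V) (e : V ≅ W) : IsSplit W := by
  obtain ⟨ι, _, ⟨e'⟩⟩ := hV
  exact ⟨ι, ‹_›, ⟨e' ≪≫ e⟩⟩

theorem isSplit_copies (ι : Type) [Finite ι] : IsSplit (copies ι) := ⟨ι, ‹_›, ⟨Iso.refl _⟩⟩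

theorem isSplit_specComplex : IsSplit specComplex := by
  refine ⟨Unit, inferInstance, ⟨?_⟩⟩
  let e : CommRingCat.of ℂ ≅ CommRingCat.of (Unit → ℂ) :=
    (RingEquiv.piUnique (fun _ : Unit => ℂ)).symm.toCommRingCatIso
  exact proEtIso (U := copies Unit) (V := specComplex) (Scheme.Spec.mapIso e.op) (by
    change Spec.map _ ≫ Spec.map _ = Spec.map _
    rw [← Spec.map_comp]
    rfl)

/-- A split object is the coproduct of a finite family of `ℂ`-points which represent the orbits of
the Galois group, and this group acts freely on the `ℂ`-points. -/
theorem IsSplit.exists_isColimit {V : specReal.ProEt} (hV : IsSplit V) :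
    ∃ (ι : Type) (_ : Finite ι) (x : ι → (specComplex ⟶ V)),
      Nonempty (IsColimit (Cofan.mk V x)) ∧
        ∀ y : specComplex ⟶ V, ∃! p : ι × (ℂ ≃ₐ[ℝ] ℂ), galMap p.2 ≫ x p.1 = y := by
  obtain ⟨ι, _, ⟨e⟩⟩ := hV
  refine ⟨ι, ‹_›, fun i => copiesInj i ≫ e.hom,
    ⟨IsColimit.ofIsoColimit (copiesIsColimit ι) (Cofan.ext e fun i => rfl)⟩, fun y => ?_⟩
  obtain ⟨p, hp, hp'⟩ := existsUnique_copiesInj (y ≫ e.inv)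
  refine ⟨p, ?_, fun q hq => hp' q ?_⟩
  · dsimp only
    rw [reassoc_of% hp, e.inv_hom_id, Category.comp_id]
  · dsimp only at hq ⊢
    rw [← hq, Category.assoc, Category.assoc, e.hom_inv_id, Category.comp_id]

theorem IsSplit.eq_one_of_galMap_comp_eq {V : specReal.ProEt} (hV : IsSplit V)
    {g : ℂ ≃ₐ[ℝ] ℂ} {y : specComplex ⟶ V} (h : galMap g ≫ y = y) : g = 1 := by
  obtain ⟨ι, _, x, -, hx⟩ := hV.exists_isColimit
  obtain ⟨⟨i, k⟩, rfl, hk⟩ := hx y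
  have := hk (i, g * k) (by
    dsimp only at h ⊢
    rw [galMap_mul, Category.assoc, h])
  simpa using congrArg Prod.snd this

/-- Morphisms from a split object are determined by their effect on `ℂ`-points. -/
theorem IsSplit.hom_ext {V Z : specReal.ProEt} (hV : IsSplit V) {a b : V ⟶ Z}
    (h : ∀ y : specComplex ⟶ V, y ≫ a = y ≫ b) : a = b := by
  obtain ⟨ι, _, x, ⟨hc⟩, -⟩ := hV.exists_isColimit
  exact Cofan.IsColimit.hom_ext hc _ _ fun i => h (x i)

/-- A Galois equivariant map between the sets of `ℂ`-points of a split object and of any object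
is induced by a morphism. -/
theorem IsSplit.exists_hom {V Z : specReal.ProEt} (hV : IsSplit V)
    (φ : (specComplex ⟶ V) → (specComplex ⟶ Z))
    (hφ : ∀ (g : ℂ ≃ₐ[ℝ] ℂ) (y : specComplex ⟶ V), φ (galMap g ≫ y) = galMap g ≫ φ y) :
    ∃ f : V ⟶ Z, ∀ y, y ≫ f = φ y := by
  obtain ⟨ι, _, x, ⟨hc⟩, hx⟩ := hV.exists_isColimit
  refine ⟨Cofan.IsColimit.desc hc fun i => φ (x i), fun y => ?_⟩
  obtain ⟨⟨i, g⟩, rfl, -⟩ := hx y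
  have : x i ≫ Cofan.IsColimit.desc hc (fun i => φ (x i)) = φ (x i) :=
    Cofan.IsColimit.fac hc (fun i => φ (x i)) i
  dsimp only
  rw [Category.assoc, this, hφ]

/-- A Galois stable set of `ℂ`-points of a split object consists of the `ℂ`-points of a split
summand. -/
theorem IsSplit.exists_summand {V : specReal.ProEt} (hV : IsSplit V)
    (s : Set (specComplex ⟶ V))
    (hs : ∀ (g : ℂ ≃ₐ[ℝ] ℂ) (y : specComplex ⟶ V), y ∈ s → galMap g ≫ y ∈ s) :
    ∃ (N : specReal.ProEt) (_ : IsSplit N) (i : N ⟶ V),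
      (∀ z z' : specComplex ⟶ N, z ≫ i = z' ≫ i → z = z') ∧
        ∀ y : specComplex ⟶ V, y ∈ s ↔ ∃ z : specComplex ⟶ N, z ≫ i = y := by
  obtain ⟨ι, _, x, -, hx⟩ := hV.exists_isColimit
  let κ : Type := {i : ι // x i ∈ s}
  let f : copies κ ⟶ V := Cofan.IsColimit.desc (copiesIsColimit κ) fun i => x i.1
  have hf (i : κ) : copiesInj i ≫ f = x i.1 :=
    Cofan.IsColimit.fac (copiesIsColimit κ) (fun i => x i.1) i
  refine ⟨copies κ, isSplit_copies κ, f, fun z z' h => ?_, fun y => ⟨fun hy => ?_, ?_⟩⟩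
  · obtain ⟨⟨i, g⟩, rfl, -⟩ := existsUnique_copiesInj z
    obtain ⟨⟨i', g'⟩, rfl, -⟩ := existsUnique_copiesInj z'
    dsimp only at h ⊢
    rw [Category.assoc, Category.assoc, hf, hf] at h
    have := (hx (galMap g ≫ x i.1)).unique (y₁ := (i.1, g)) (y₂ := (i'.1, g')) rfl h.symm
    obtain rfl : i = i' := Subtype.ext (congrArg Prod.fst this)
    obtain rfl : g = g' := congrArg Prod.snd this
    rfl
  · obtain ⟨⟨i, g⟩, rfl, -⟩ := hx y
    have hi : x i ∈ s := by
      have := hs g⁻¹ _ hy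
      dsimp only at this
      rwa [← Category.assoc, ← galMap_mul, inv_mul_cancel, galMap_one, Category.id_comp] at this
    refine ⟨galMap g ≫ copiesInj (⟨i, hi⟩ : κ), ?_⟩
    rw [Category.assoc, hf]
  · rintro ⟨z, rfl⟩
    obtain ⟨⟨i, g⟩, rfl, -⟩ := existsUnique_copiesInj z
    dsimp only
    rw [Category.assoc, hf]
    exact hs _ _ i.2

/-- A cofan of split objects is a coproduct if it is a coproduct on `ℂ`-points. -/
theorem IsSplit.nonempty_isColimit {V : specReal.ProEt} (hV : IsSplit V) {J : Type*}
    (N : J → specReal.ProEt) (hN : ∀ j, IsSplit (N j)) (i : ∀ j, N j ⟶ V)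
    (h : ∀ y : specComplex ⟶ V, ∃! p : Σ j, (specComplex ⟶ N j), p.2 ≫ i p.1 = y) :
    Nonempty (IsColimit (Cofan.mk V i)) := by
  choose q hq hq' using h
  dsimp only at hq hq'
  have key (Z : specReal.ProEt) (f : ∀ j, N j ⟶ Z) :
      ∃ d : V ⟶ Z, ∀ y, y ≫ d = (q y).2 ≫ f (q y).1 := by
    refine hV.exists_hom _ fun g y => ?_
    have := hq' (galMap g ≫ y) ⟨(q y).1, galMap g ≫ (q y).2⟩
      (by rw [Category.assoc, hq])
    rw [← this, Category.assoc]
  choose d hd using key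
  refine ⟨Cofan.IsColimit.mk _ (fun s => d s.pt s.inj) (fun s j => ?_) (fun s m hm => ?_)⟩
  · refine (hN j).hom_ext fun z => ?_
    have := hq' (z ≫ i j) ⟨j, z⟩ rfl
    refine (Category.assoc _ _ _).symm.trans ((hd s.pt s.inj (z ≫ i j)).trans ?_)
    rw [← this]
  · refine hV.hom_ext fun y => ?_
    rw [hd, ← hm (q y).1]
    exact (congrArg (· ≫ m) (hq y).symm).trans (Category.assoc _ _ _)

theorem IsSplit.isAffine {V : specReal.ProEt} (hV : IsSplit V) : IsAffine V.left := by
  obtain ⟨ι, _, ⟨e⟩⟩ := hV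
  have : IsAffine (copies ι).left := inferInstanceAs (IsAffine (Spec _))
  let e' : V.left ≅ (copies ι).left := (underlyingScheme specReal).mapIso e.symm
  exact IsAffine.of_isIso e'.hom

/-- Different summands of `ℂ ^ ι` have no points in common. -/
theorem specMap_evalRingHom_ne {ι : Type} {i j : ι} (hij : i ≠ j)
    (a b : Spec (CommRingCat.of ℂ)) :
    Spec.map (CommRingCat.ofHom (Pi.evalRingHom (fun _ : ι => ℂ) i)) a ≠
      Spec.map (CommRingCat.ofHom (Pi.evalRingHom (fun _ : ι => ℂ) j)) b := by
  classical
  intro h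
  have h1 : (Pi.single i 1 : ι → ℂ) ∈
      (Spec.map (CommRingCat.ofHom (Pi.evalRingHom (fun _ : ι => ℂ) j)) b).asIdeal := by
    change Pi.evalRingHom (fun _ : ι => ℂ) j (Pi.single i 1) ∈ b.asIdeal
    simp [hij.symm]
  rw [← h] at h1
  have h2 : Pi.evalRingHom (fun _ : ι => ℂ) i (Pi.single i 1) ∈ a.asIdeal := h1
  simp only [Pi.evalRingHom_apply, Pi.single_eq_same] at h2
  exact a.2.ne_top ((Ideal.eq_top_iff_one _).2 h2)

theorem exists_specMap_evalRingHom {ι : Type} [Finite ι] (x : Spec (CommRingCat.of (ι → ℂ))) :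
    ∃ (i : ι) (a : Spec (CommRingCat.of ℂ)),
      Spec.map (CommRingCat.ofHom (Pi.evalRingHom (fun _ : ι => ℂ) i)) a = x := by
  let R : ι → CommRingCat.{0} := fun _ => CommRingCat.of ℂ
  obtain ⟨y, rfl⟩ := (sigmaSpec R).surjective x
  obtain ⟨i, z, rfl⟩ := (sigmaOpenCover fun i => Spec (R i)).exists_eq y
  exact ⟨i, z, congrArg (fun f : Spec (CommRingCat.of ℂ) ⟶ Spec (CommRingCat.of (ι → ℂ)) => f z)
    (ι_sigmaSpec R i).symm⟩

/-- An object which maps compatibly to different summands of `copies ι` is empty. -/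
theorem copies_isEmpty {Y : specReal.ProEt} {ι : Type} [Finite ι] {i j : ι} (hij : i ≠ j)
    (a b : Y ⟶ specComplex) (h : a ≫ copiesInj i = b ≫ copiesInj j) : IsEmpty Y.left := by
  refine ⟨fun y => ?_⟩
  have h' := congrArg (underlyingScheme specReal).map h
  rw [Functor.map_comp, Functor.map_comp] at h'
  let a' : Y.left ⟶ Spec (CommRingCat.of ℂ) := (underlyingScheme specReal).map a
  let b' : Y.left ⟶ Spec (CommRingCat.of ℂ) := (underlyingScheme specReal).map b
  exact specMap_evalRingHom_ne hij (a' y) (b' y)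
    (congrArg (fun f : Y.left ⟶ Spec (CommRingCat.of (ι → ℂ)) => f y) h')

theorem copiesInj_cancel {Y : specReal.ProEt} {ι : Type} [Finite ι] {i : ι}
    {a b : Y ⟶ specComplex} (h : a ≫ copiesInj i = b ≫ copiesInj i) : a = b := by
  have h' := congrArg (underlyingScheme specReal).map h
  rw [Functor.map_comp, Functor.map_comp] at h'
  have : Mono (Spec.map (CommRingCat.ofHom (Pi.evalRingHom (fun _ : ι => ℂ) i))) := inferInstance
  exact proEt_hom_ext (this.right_cancellation _ _ h')

theorem ofArrows_copiesInj_mem_precoverage (ι : Type) [Finite ι] :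
    Presieve.ofArrows (fun _ : ι => specComplex) copiesInj ∈
      Scheme.ProEt.precoverage specReal (copies ι) := by
  change Presieve.map (underlyingScheme specReal) (Presieve.ofArrows _ _) ∈
    Scheme.proetalePrecoverage ((underlyingScheme specReal).obj (copies ι))
  rw [Presieve.map_ofArrows]
  have hopen (i : ι) : IsOpenImmersion ((underlyingScheme specReal).map (copiesInj i)) := by
    change IsOpenImmersion (Spec.map (CommRingCat.ofHom (Pi.evalRingHom (fun _ : ι => ℂ) i)))
    infer_instance
  refine ⟨Scheme.zariskiPrecoverage_le_qcPrecoverage _ ?_, ?_⟩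
  · exact Scheme.ofArrows_mem_precoverage_iff _ |>.2 ⟨exists_specMap_evalRingHom, hopen⟩
  · exact Scheme.ofArrows_mem_precoverage_iff _ |>.2 ⟨exists_specMap_evalRingHom, fun i =>
      have := hopen i
      inferInstance⟩

/-- Split objects are weakly contractible. A section over `copies ι` lifts locally, hence over
each copy of `Spec ℂ`, and these lifts can be glued as the copies are disjoint. -/
theorem IsSplit.isWeaklyContractible {V : specReal.ProEt} (hV : IsSplit V) :
    IsWeaklyContractible V := by
  intro F G φ hφ s
  obtain ⟨ι, _, ⟨e⟩⟩ := hV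
  have hsheaf (H : Sheaf (Scheme.ProEt.topology specReal) (Type 1)) :
      (Presieve.ofArrows (fun _ : ι => specComplex) copiesInj).IsSheafFor H.obj := by
    rw [Presieve.isSheafFor_iff_generate]
    exact (isSheaf_iff_isSheaf_of_type _ _).1 H.property _
      (Precoverage.generate_mem_toGrothendieck (ofArrows_copiesInj_mem_precoverage ι))
  have hlift (i : ι) : ∃ t : F.obj.obj (op specComplex),
      φ.hom.app _ t = G.obj.map (copiesInj i ≫ e.hom).op s := by
    have h : Presheaf.imageSieve φ.hom s ∈ Scheme.ProEt.topology specReal V :=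
      Presheaf.imageSieve_mem (Scheme.ProEt.topology specReal) φ.hom s
    exact mem_of_mem_topology specComplexToSpecReal h (copiesInj i ≫ e.hom)
  choose t ht using hlift
  obtain ⟨t', ht', -⟩ := (Presieve.isSheafFor_arrows_iff _ _).1 (hsheaf F) t (by
    intro i j Y a b hab
    by_cases hij : i = j
    · subst hij
      rw [copiesInj_cancel hab]
    · have := copies_isEmpty hij a b hab
      have hbot := (isSheaf_iff_isSheaf_of_type _ _).1 F.property _
        (Scheme.ProEt.bot_mem_topology Y)
      exact hbot.isSeparatedFor.ext (by rintro _ _ ⟨⟩))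
  refine ⟨F.obj.map e.inv.op t', ?_⟩
  have hs : φ.hom.app _ t' = G.obj.map e.hom.op s := by
    refine (hsheaf G).isSeparatedFor.ext ?_
    rintro _ _ ⟨i⟩
    rw [← NatTrans.naturality_apply, ht' i, ht i, op_comp, Functor.map_comp_apply]
  rw [NatTrans.naturality_apply, hs, ← Functor.map_comp_apply, ← op_comp, e.inv_hom_id, op_id,
    Functor.map_id_apply]

theorem natCard_galoisGroup : Nat.card (ℂ ≃ₐ[ℝ] ℂ) = 2 := by
  have : IsAlgClosure ℝ ℂ := ⟨inferInstance, inferInstance⟩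
  have : IsGalois ℝ ℂ := IsAlgClosure.isGalois ℝ ℂ
  rw [IsGalois.card_aut_eq_finrank, Complex.finrank_real_complex]

/-- The homomorphism `ℂ ^ ι ⊗ ℂ → ℂ ^ (ι × Gal(ℂ/ℝ))` which maps `f ⊗ z` to the function
`(i, g) ↦ f i * g z`. -/
noncomputable def piTensorHom (ι : Type) :
    TensorProduct ℝ (ι → ℂ) ℂ →ₐ[ℝ] (ι × (ℂ ≃ₐ[ℝ] ℂ) → ℂ) :=
  Algebra.TensorProduct.productMap
    (AlgHom.pi fun p => Pi.evalAlgHom ℝ (fun _ : ι => ℂ) p.1)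
    (AlgHom.pi fun p => (p.2 : ℂ →ₐ[ℝ] ℂ))

theorem piTensorHom_tmul (ι : Type) (f : ι → ℂ) (z : ℂ) (p : ι × (ℂ ≃ₐ[ℝ] ℂ)) :
    piTensorHom ι (TensorProduct.tmul ℝ f z) p = f p.1 * p.2 z := rfl

open TensorProduct in
theorem bijective_piTensorHom (ι : Type) [Finite ι] : Function.Bijective (piTensorHom ι) := by
  classical
  have := Fintype.ofFinite ι
  have hsq (g : ℂ ≃ₐ[ℝ] ℂ) : g Complex.I * g Complex.I = -1 := by
    rw [← map_mul, Complex.I_mul_I, map_neg, map_one]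
  -- the idempotent which cuts out the component of `g`
  let u (g : ℂ ≃ₐ[ℝ] ℂ) : (ι → ℂ) ⊗[ℝ] ℂ :=
    Function.const ι (1 / 2) ⊗ₜ 1 - Function.const ι (g Complex.I / 2) ⊗ₜ Complex.I
  have hu (g : ℂ ≃ₐ[ℝ] ℂ) (p : ι × (ℂ ≃ₐ[ℝ] ℂ)) :
      piTensorHom ι (u g) p = if p.2 = g then 1 else 0 := by
    have hval : piTensorHom ι (u g) p = 1 / 2 - g Complex.I / 2 * p.2 Complex.I := by
      dsimp only [u]
      rw [map_sub, Pi.sub_apply, piTensorHom_tmul, piTensorHom_tmul]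
      simp
    rw [hval]
    split_ifs with h
    · rw [h]
      linear_combination (-1 / 2) * hsq g
    · have hne : p.2 Complex.I ≠ g Complex.I := fun hI => h (AlgEquiv.coe_toAlgHom_injective
        (Complex.algHom_ext hI))
      have hI : p.2 Complex.I = -g Complex.I :=
        (mul_self_eq_mul_self_iff.1 ((hsq p.2).trans (hsq g).symm)).resolve_left hne
      rw [hI]
      linear_combination (1 / 2) * hsq g
  have hsurj : Function.Surjective (piTensorHom ι) := by
    intro h
    refine ⟨∑ p, (Pi.single p.1 (h p) ⊗ₜ 1) * u p.2, ?_⟩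
    ext q
    rw [map_sum, Finset.sum_apply, Finset.sum_eq_single q]
    · rw [map_mul, Pi.mul_apply, hu, piTensorHom_tmul]
      simp
    · intro p _ hpq
      rw [map_mul, Pi.mul_apply, hu, piTensorHom_tmul]
      by_cases h2 : q.2 = p.2
      · have h1 : q.1 ≠ p.1 := fun h1 => hpq (Prod.ext h1 h2).symm
        simp [h1]
      · simp [h2]
    · simp
  refine ⟨?_, hsurj⟩
  have hrank : Module.finrank ℝ ((ι → ℂ) ⊗[ℝ] ℂ) =
      Module.finrank ℝ (ι × (ℂ ≃ₐ[ℝ] ℂ) → ℂ) := by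
    rw [Module.finrank_tensorProduct, Module.finrank_pi_fintype, Module.finrank_pi_fintype]
    simp [Complex.finrank_real_complex, ← Nat.card_eq_fintype_card, natCard_galoisGroup]
  exact (LinearMap.injective_iff_surjective_of_finrank_eq_finrank (f := (piTensorHom ι).toLinearMap)
    hrank).2 hsurj

/-- The product of a split object and `Spec ℂ` is split. -/
theorem IsSplit.proEtProduct {V : specReal.ProEt} (hV : IsSplit V) :
    IsSplit (proEtProduct V specComplex) := by
  obtain ⟨ι, _, ⟨e⟩⟩ := hV
  let Ψ : CommRingCat.of (TensorProduct ℝ (ι → ℂ) ℂ) ≅ CommRingCat.of (ι × (ℂ ≃ₐ[ℝ] ℂ) → ℂ) :=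
    (RingEquiv.ofBijective (piTensorHom ι) (bijective_piTensorHom ι)).toCommRingCatIso
  let e₁ : Spec (CommRingCat.of (ι × (ℂ ≃ₐ[ℝ] ℂ) → ℂ)) ≅
      pullback (specPiToSpecReal ι) specComplexToSpecReal :=
    Scheme.Spec.mapIso Ψ.op ≪≫ (pullbackSpecIso ℝ (ι → ℂ) ℂ).symm
  have h₁ : e₁.hom ≫ pullback.fst (specPiToSpecReal ι) specComplexToSpecReal ≫
      specPiToSpecReal ι = specPiToSpecReal (ι × (ℂ ≃ₐ[ℝ] ℂ)) := by
    change (Spec.map Ψ.hom ≫ (pullbackSpecIso ℝ (ι → ℂ) ℂ).inv) ≫ _ = _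
    rw [Category.assoc, pullbackSpecIso_inv_fst_assoc, ← Spec.map_comp, ← Spec.map_comp]
    congr 1
    refine CommRingCat.hom_ext (RingHom.ext fun r => ?_)
    exact (piTensorHom ι).commutes r
  have e₂ : copies (ι × (ℂ ≃ₐ[ℝ] ℂ)) ≅ ProEtaleHomotopy.proEtProduct (copies ι) specComplex :=
    proEtIso e₁ h₁
  refine (isSplit_copies (ι × (ℂ ≃ₐ[ℝ] ℂ))).of_iso (e₂ ≪≫ ?_)
  exact IsLimit.conePointsIsoOfNatIso (proEtProductIsLimit _ _) (proEtProductIsLimit _ _)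
    (mapPairIso e (Iso.refl _))

/-- All objects which are the product of a split object with `Spec ℂ` are split. -/
theorem IsSplit.of_isLimit {V : specReal.ProEt} (hV : IsSplit V) {c : BinaryFan V specComplex}
    (hc : IsLimit c) : IsSplit c.pt :=
  hV.proEtProduct.of_iso ((proEtProductIsLimit V specComplex).conePointUniqueUpToIso hc)

end SplitObjects

/-! ### Coskeleta -/

section Coskeleta

universe v u

variable {C : Type u} [Category.{v} C] [HasFiniteLimits C]

/-- The `T`-points of the coskeleton of `F` in degree `m` are the compatible families of `T`-points
of `F` indexed by the simplices of `Δ[m]` of dimension at most `n`. -/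
theorem existsUnique_hom_cosk (n : ℕ) (F : SimplicialObject.Truncated C n)
    (m : SimplexCategoryᵒᵖ) {T : C}
    (x : ∀ j : StructuredArrow m (SimplexCategory.Truncated.inclusion n).op, T ⟶ F.obj j.right)
    (hx : ∀ {j j' : StructuredArrow m (SimplexCategory.Truncated.inclusion n).op} (a : j ⟶ j'),
      x j ≫ F.map a.right = x j') :
    ∃! t : T ⟶ ((SimplicialObject.Truncated.cosk n).obj F).obj m, ∀ j,
      t ≫ ((SimplicialObject.Truncated.cosk n).obj F).map j.hom ≫
        ((SimplicialObject.coskAdj n).counit.app F).app j.right = x j := by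
  have e : (SimplicialObject.coskAdj (C := C) n).counit =
      (SimplexCategory.Truncated.inclusion n).op.ranCounit :=
    Functor.ranAdjunction_counit _ _
  rw [e]
  let hl := (SimplexCategory.Truncated.inclusion n).op.isPointwiseRightKanExtensionRanCounit F m
  let c : Cone (StructuredArrow.proj m (SimplexCategory.Truncated.inclusion n).op ⋙ F) :=
    { pt := T
      π := { app := x, naturality := fun j j' a => (Category.id_comp _).trans (hx a).symm } }
  refine ⟨hl.lift c, fun j => hl.fac c j, fun t ht => hl.uniq c t fun j => ht j⟩

theorem coskAdj_unit_app_comp (n : ℕ) (U : SimplicialObject C) (m : SimplexCategoryᵒᵖ)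
    (j : StructuredArrow m (SimplexCategory.Truncated.inclusion n).op) :
    ((SimplicialObject.coskAdj n).unit.app U).app m ≫
      ((SimplicialObject.cosk n).obj U).map j.hom ≫
        ((SimplicialObject.coskAdj n).counit.app ((SimplicialObject.truncation n).obj U)).app
          j.right = U.map j.hom := by
  have h₁ := ((SimplicialObject.coskAdj n).unit.app U).naturality j.hom
  have h₂ := NatTrans.congr_app ((SimplicialObject.coskAdj n).left_triangle_components U) j.right
  refine (Category.assoc _ _ _).symm.trans ((congrArg (· ≫ ((SimplicialObject.coskAdj n).counit.app
    ((SimplicialObject.truncation n).obj U)).app j.right) h₁.symm).trans ?_)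
  refine (Category.assoc _ _ _).trans ((congrArg (U.map j.hom ≫ ·) h₂).trans ?_)
  exact Category.comp_id _

/-- The projection of the coskeleton `cosk₀ X` in degree zero onto `X`. -/
noncomputable def vertexMap (X : C) : (cosk₀ X) _⦋0⦌ ⟶ X :=
  ((SimplicialObject.coskAdj 0).counit.app ((Functor.const _).obj X)).app
    (op ⟨⦋0⦌, Nat.le_refl 0⟩)

/-- The projection of `cosk₀ X` onto `X` at the vertex `i`. -/
noncomputable def coord (X : C) {n : SimplexCategory} (i : ⦋0⦌ ⟶ n) : (cosk₀ X).obj (op n) ⟶ X :=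
  (cosk₀ X).map i.op ≫ vertexMap X

theorem map_coord (X : C) {n m : SimplexCategory} (a : n ⟶ m) (i : ⦋0⦌ ⟶ n) :
    (cosk₀ X).map a.op ≫ coord X i = coord X (i ≫ a) := by
  rw [coord, coord, op_comp, Functor.map_comp, Category.assoc]

/-- The universal property of `cosk₀ X`: in degree `n`, it is the product of copies of `X` indexed
by the vertices of `Δ[n]`. -/
theorem existsUnique_coord (X : C) {n : SimplexCategory} {T : C} (x : (⦋0⦌ ⟶ n) → (T ⟶ X)) :
    ∃! t : T ⟶ (cosk₀ X).obj (op n), ∀ i, t ≫ coord X i = x i := by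
  have hsub (Y : SimplexCategory.Truncated 0) (a b : ⦋0⦌ ⟶ Y.obj) : a = b := by
    obtain ⟨Y, hY⟩ := Y
    obtain rfl : Y = ⦋0⦌ := SimplexCategory.ext (Nat.le_zero.1 hY)
    exact Subsingleton.elim _ _
  let x' (j : StructuredArrow (op n) (SimplexCategory.Truncated.inclusion 0).op) : T ⟶ X :=
    x ((SimplexCategory.const ⦋0⦌ j.right.unop.obj 0) ≫ j.hom.unop)
  obtain ⟨t, ht, ht'⟩ := existsUnique_hom_cosk 0 ((Functor.const _).obj X) (op n) x' (by
    intro j j' a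
    refine (Category.comp_id _).trans (congrArg x ?_)
    rw [← StructuredArrow.w a]
    exact (congrArg (· ≫ j.hom.unop) (hsub j.right.unop _ _)).trans (Category.assoc _ _ _))
  refine ⟨t, fun i => ?_, fun t' h => ht' t' fun j => ?_⟩
  · refine (ht (StructuredArrow.mk (Y := op (⟨⦋0⦌, Nat.le_refl 0⟩ : SimplexCategory.Truncated 0))
      i.op)).trans (congrArg x ?_)
    exact (congrArg (· ≫ i) (Subsingleton.elim _ (𝟙 ⦋0⦌))).trans (Category.id_comp i)
  · obtain ⟨⟨⟨⟩⟩, ⟨Y, hY⟩, f⟩ := j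
    obtain rfl : Y = ⦋0⦌ := SimplexCategory.ext (Nat.le_zero.1 hY)
    refine (h f.unop).trans (congrArg x ?_)
    exact ((congrArg (· ≫ f.unop) (Subsingleton.elim _ (𝟙 ⦋0⦌))).trans (Category.id_comp _)).symm

theorem hom_coord_ext (X : C) {n : SimplexCategory} {T : C} {s t : T ⟶ (cosk₀ X).obj (op n)}
    (h : ∀ i, s ≫ coord X i = t ≫ coord X i) : s = t :=
  (existsUnique_coord X fun i => t ≫ coord X i).unique h fun _ => rfl

/-- Morphisms to `cosk₀ X` are determined by what they do in degree zero. -/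
theorem cosk₀_hom_ext {X : C} {Y : SimplicialObject C} {f g : Y ⟶ cosk₀ X}
    (h : f.app (op ⦋0⦌) = g.app (op ⦋0⦌)) : f = g := by
  ext n
  refine hom_coord_ext X fun i => ?_
  rw [coord, ← NatTrans.naturality_assoc, ← NatTrans.naturality_assoc, h]

/-- Morphisms to `cosk₀ X` are given by morphisms in degree zero. -/
theorem exists_hom_cosk₀ {X : C} {Y : SimplicialObject C} (f : Y _⦋0⦌ ⟶ X) :
    ∃ g : Y ⟶ cosk₀ X, g.app (op ⦋0⦌) ≫ vertexMap X = f := by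
  choose g hg using fun n : SimplexCategoryᵒᵖ =>
    (existsUnique_coord X (n := n.unop) (T := Y.obj n) fun i => Y.map i.op ≫ f).exists
  refine ⟨{ app := g, naturality := fun n m a => hom_coord_ext X fun i => ?_ }, ?_⟩
  · rw [Category.assoc, hg, Category.assoc]
    refine Eq.trans ?_ (congrArg (g n ≫ ·) (map_coord X a.unop i)).symm
    rw [hg]
    simp
  · have := hg (op ⦋0⦌) (𝟙 _)
    rw [coord] at this
    simpa using this

theorem isIso_vertexMap (X : C) : IsIso (vertexMap X) := by
  have e : coord X (𝟙 ⦋0⦌) = vertexMap X := by simp [coord]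
  have h (i : ⦋0⦌ ⟶ ⦋0⦌) : i = 𝟙 _ := Subsingleton.elim _ _
  obtain ⟨s, hs, -⟩ := existsUnique_coord X (n := ⦋0⦌) (fun _ => 𝟙 X)
  rw [← e]
  refine ⟨s, hom_coord_ext X fun i => ?_, hs _⟩
  rw [h i, Category.assoc, hs, Category.comp_id, Category.id_comp]

/-- In positive degree, `cosk₀ X` is the product of the previous degree and `X`. -/
noncomputable def coskSuccIsLimit (X : C) (n : ℕ) :
    IsLimit (BinaryFan.mk ((cosk₀ X).map (SimplexCategory.δ (Fin.last (n + 1))).op)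
      (coord X (SimplexCategory.const ⦋0⦌ ⦋n + 1⦌ (Fin.last (n + 1))))) := by
  have hδ (k : Fin (n + 1)) : SimplexCategory.const ⦋0⦌ ⦋n⦌ k ≫
      SimplexCategory.δ (Fin.last (n + 1)) = SimplexCategory.const ⦋0⦌ ⦋n + 1⦌ k.castSucc := by
    rw [SimplexCategory.const_comp]
    congr 1
    exact Fin.succAbove_last_apply k
  have key (s : BinaryFan ((cosk₀ X) _⦋n⦌) X) := existsUnique_coord X (n := ⦋n + 1⦌) (T := s.pt)
    fun i => Fin.lastCases (motive := fun _ => s.pt ⟶ X) s.snd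
      (fun k => s.fst ≫ coord X (SimplexCategory.const ⦋0⦌ ⦋n⦌ k)) (i.toOrderHom 0)
  choose t ht ht' using key
  have ht₁ (s : BinaryFan ((cosk₀ X) _⦋n⦌) X) (k : Fin (n + 1)) :
      t s ≫ coord X (SimplexCategory.const ⦋0⦌ ⦋n + 1⦌ k.castSucc) =
        s.fst ≫ coord X (SimplexCategory.const ⦋0⦌ ⦋n⦌ k) :=
    (ht s _).trans (Fin.lastCases_castSucc ..)
  have ht₂ (s : BinaryFan ((cosk₀ X) _⦋n⦌) X) :
      t s ≫ coord X (SimplexCategory.const ⦋0⦌ ⦋n + 1⦌ (Fin.last (n + 1))) = s.snd :=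
    (ht s _).trans (Fin.lastCases_last ..)
  refine BinaryFan.isLimitMk t (fun s => hom_coord_ext X fun i => ?_) ht₂ fun s m h₁ h₂ =>
    hom_coord_ext X fun i => ?_
  · obtain ⟨k, rfl⟩ : ∃ k, i = SimplexCategory.const ⦋0⦌ ⦋n⦌ k :=
      ⟨_, SimplexCategory.eq_const_of_zero i⟩
    rw [Category.assoc, map_coord, hδ, ht₁]
    rfl
  · obtain ⟨k, rfl⟩ : ∃ k, i = SimplexCategory.const ⦋0⦌ ⦋n + 1⦌ k :=
      ⟨_, SimplexCategory.eq_const_of_zero i⟩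
    induction k using Fin.lastCases with
    | last => rw [h₂, ht₂]
    | cast k => 
      rw [ht₁, ← hδ, ← map_coord, reassoc_of% h₁]
      rfl

/-- `cosk₀ X` is `n`-coskeletal for all `n`. -/
theorem isIso_coskAdj_unit_cosk₀ (X : C) (n : ℕ) :
    IsIso ((SimplicialObject.coskAdj n).unit.app (cosk₀ X)) := by
  let adj := SimplicialObject.coskAdj (C := C) n
  let η := adj.unit.app (cosk₀ X)
  have : IsIso adj.counit := Functor.reflective' (SimplexCategory.Truncated.inclusion n).op
  have htr : IsIso ((SimplicialObject.truncation n).map η) :=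
    @IsIso.of_isIso_fac_right _ _ _ _ _ _ _ _ inferInstance (IsIso.id _)
      (adj.left_triangle_components (cosk₀ X))
  have h₀ : IsIso (η.app (op ⦋0⦌)) :=
    inferInstanceAs (IsIso (((SimplicialObject.truncation n).map η).app
      (op ⟨⦋0⦌, Nat.zero_le n⟩)))
  have := isIso_vertexMap X
  -- a retraction exists because `cosk₀ X` is `0`-coskeletal
  obtain ⟨r, hr⟩ := exists_hom_cosk₀ (inv (η.app (op ⦋0⦌)) ≫ vertexMap X)
  have hη : η ≫ r = 𝟙 _ := by
    refine cosk₀_hom_ext ?_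
    rw [← cancel_mono (vertexMap X)]
    change (η.app (op ⦋0⦌) ≫ r.app (op ⦋0⦌)) ≫ vertexMap X = 𝟙 _ ≫ vertexMap X
    rw [Category.assoc, hr, IsIso.hom_inv_id_assoc, Category.id_comp]
  -- it is inverse to `η`, as endomorphisms of a coskeleton are determined by their truncations
  refine ⟨r, hη, (adj.homEquiv _ _).symm.injective ?_⟩
  have h' : (SimplicialObject.truncation n).map (r ≫ η) = 𝟙 _ := by
    have h₁ := congrArg (SimplicialObject.truncation n).map hη
    rw [Functor.map_comp, CategoryTheory.Functor.map_id] at h₁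
    rw [Functor.map_comp, ← IsIso.inv_eq_of_hom_inv_id h₁, IsIso.inv_hom_id]
  change (adj.homEquiv _ _).symm (r ≫ η) = _
  rw [adj.homEquiv_counit, adj.homEquiv_counit, h']
  congr 1

end Coskeleta

/-! ### Hypercoverings of `Spec ℝ` and their complex points -/

section Hypercoverings

/-- The object `cosk₀(Spec ℂ)` in degree `n` is the product of `n + 1` copies of `Spec ℂ`. -/
theorem isSplit_cosk₀ (n : ℕ) : IsSplit ((cosk₀ specComplex) _⦋n⦌) := by
  induction n with
  | zero =>
    have := isIso_vertexMap specComplex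
    exact isSplit_specComplex.of_iso (asIso (vertexMap specComplex)).symm
  | succ n ih => exact ih.of_isLimit (coskSuccIsLimit specComplex n)

/-- The matching morphisms in positive degree are even isomorphisms. -/
theorem isHypercovering_cosk₀_specComplex :
    IsHypercovering (Scheme.ProEt.precoverage specReal) (cosk₀ specComplex) := by
  refine ⟨?_, fun n => ?_⟩
  · let W := (cosk₀ specComplex) _⦋0⦌
    let T : specReal.ProEt := Scheme.ProEt.mk (𝟙 specReal)
    have hT : IsTerminal T := IsTerminal.ofUniqueHom
      (fun X => proEtHom (V := T) X.hom (Category.comp_id _)) fun X m => proEt_hom_ext <| by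
        exact (Category.comp_id _).symm.trans (underlyingScheme_map_w m)
    let e : T.left ≅ (⊤_ specReal.ProEt).left :=
      (underlyingScheme specReal).mapIso (hT.uniqueUpToIso terminalIsTerminal)
    have : IsAffine (⊤_ specReal.ProEt).left := by
      have : IsAffine T.left := inferInstanceAs (IsAffine (Spec _))
      exact IsAffine.of_isIso e.inv
    have : IsAffine W.left := (isSplit_cosk₀ 0).isAffine
    let f : W.left ⟶ (⊤_ specReal.ProEt).left :=
      (underlyingScheme specReal).map (terminal.from W)
    have : QuasiCompact f := inferInstance
    have : Surjective f := by
      refine ⟨fun x => ?_⟩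
      have := isIso_vertexMap specComplex
      let g : Spec (CommRingCat.of ℂ) ⟶ W.left :=
        (underlyingScheme specReal).map (inv (vertexMap specComplex))
      refine ⟨g (⊥ : PrimeSpectrum ℂ), ?_⟩
      have hs : Subsingleton (⊤_ specReal.ProEt).left := by
        have : Subsingleton T.left := inferInstanceAs (Subsingleton (PrimeSpectrum ℝ))
        exact e.inv.homeomorph.injective.subsingleton
      exact Subsingleton.elim _ _
    exact @singleton_mem_precoverage _ _ _ (terminal.from W) ‹Surjective f› ‹QuasiCompact f›
  · let η := ((SimplicialObject.coskAdj n).unit.app (cosk₀ specComplex)).app (op ⦋n + 1⦌)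
    have : IsIso η := by
      have := isIso_coskAdj_unit_cosk₀ specComplex n
      infer_instance
    exact singleton_mem_precoverage η

/-- The simplicial set of `ℂ`-points of a simplicial object, with the action of the Galois group. -/
noncomputable def points (U : SimplicialObject specReal.ProEt) :
    Action SSet.{0} (ℂ ≃ₐ[ℝ] ℂ) where
  V := U ⋙ coyoneda.obj (op specComplex)
  ρ :=
    { toFun g := ((Functor.whiskeringLeft _ _ _).obj U).map (coyoneda.map (galMap g).op)
      map_one' := by
        rw [galMap_one, op_id, CategoryTheory.Functor.map_id, CategoryTheory.Functor.map_id]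
        rfl
      map_mul' g h := by
        rw [galMap_mul, op_comp, Functor.map_comp, Functor.map_comp]
        rfl }

/-- The simplicial set of `ℂ`-points of a hypercovering is a contractible Kan complex. -/
theorem IsHypercovering.exists_points_lift {U : SimplicialObject specReal.ProEt}
    (hU : IsHypercovering (Scheme.ProEt.precoverage specReal) U) (n : ℕ)
    (f : (∂Δ[n] : SSet.{0}) ⟶ (points U).V) : ∃ h : Δ[n] ⟶ (points U).V, ∂Δ[n].ι ≫ h = f := by
  cases n with
  | zero =>
    obtain ⟨_, _, ⟨⟩, s, -⟩ := exists_lift_of_mem_precoverage specComplexToSpecReal hU.1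
      (terminal.from specComplex)
    exact ⟨SSet.yonedaEquiv.symm (show (points U).V _⦋0⦌ from s), SSet.boundary.hom_ext₀⟩
  | succ n =>
    let s (j : StructuredArrow (op ⦋n + 1⦌) (SimplexCategory.Truncated.inclusion n).op) :
        (∂Δ[n + 1] : SSet.{0}).obj (op j.right.unop.obj) :=
      ⟨SSet.stdSimplex.objEquiv.symm j.hom.unop, by
        obtain ⟨⟨⟨⟩⟩, ⟨Y, hY⟩, a⟩ := j
        have := SSet.boundary_obj_eq_univ.{0} Y.len (n + 1) (Nat.lt_succ_of_le hY)
        exact this.symm ▸ Set.mem_univ _⟩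
    -- the restrictions of `f` to the simplices of the boundary define a point of the coskeleton
    obtain ⟨t, ht, -⟩ := existsUnique_hom_cosk n ((SimplicialObject.truncation n).obj U)
      (op ⦋n + 1⦌) (T := specComplex) (fun j => f.app _ (s j)) (by
        intro j j' a
        have h₁ := NatTrans.naturality_apply f
          ((SimplexCategory.Truncated.inclusion n).op.map a.right) (s j)
        refine h₁.symm.trans (congrArg (f.app _) (Subtype.ext ?_))
        change SSet.stdSimplex.objEquiv.symm _ = SSet.stdSimplex.objEquiv.symm _
        congr 1
        rw [← StructuredArrow.w a]
        rfl)
    obtain ⟨_, _, ⟨⟩, u, hu⟩ := exists_lift_of_mem_precoverage specComplexToSpecReal (hU.2 n) t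
    let u' : (points U).V _⦋n + 1⦌ := u
    refine ⟨SSet.yonedaEquiv.symm u', SSet.boundary.hom_ext fun i => ?_⟩
    rw [SSet.boundary.ι_ι_assoc]
    apply SSet.yonedaEquiv.injective
    let j : StructuredArrow (op ⦋n + 1⦌) (SimplexCategory.Truncated.inclusion n).op :=
      StructuredArrow.mk (Y := op (⟨⦋n⦌, Nat.le_refl n⟩ : SimplexCategory.Truncated n))
        (SimplexCategory.δ i).op
    have h₁ : SSet.yonedaEquiv (SSet.boundary.ι i ≫ f) = f.app _ (s j) := by
      refine congrArg (f.app (op ⦋n⦌)) (Subtype.ext ?_)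
      exact (congrArg SSet.yonedaEquiv (SSet.boundary.ι_ι i)).trans (SSet.yonedaEquiv_map _)
    have h₂ : SSet.yonedaEquiv (SSet.stdSimplex.δ i ≫ SSet.yonedaEquiv.symm u') =
        u ≫ U.map (SimplexCategory.δ i).op := by
      rw [SSet.stdSimplex.δ_comp_yonedaEquiv_symm, Equiv.apply_symm_apply]
      rfl
    rw [h₁, h₂]
    refine Eq.trans ?_ (ht j)
    rw [← hu]
    have h₃ := coskAdj_unit_app_comp n U (op ⦋n + 1⦌) j
    exact (congrArg (u ≫ ·) h₃).symm.trans (Category.assoc _ _ _).symm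

end Hypercoverings

/-! ### The homotopy category of hypercoverings -/

section SplitSimplicialObjects

/-- The map on `ℂ`-points induced by a morphism of simplicial objects. -/
noncomputable def pointsMap {W U : SimplicialObject specReal.ProEt} (f : W ⟶ U) :
    points W ⟶ points U :=
  equivariantMap (B := points W) (X := points U) (Functor.whiskerRight f _) fun g _ y =>
    Category.assoc (galMap g) y _

variable {W U : SimplicialObject specReal.ProEt}

theorem eq_one_of_smul_points_eq (hW : ∀ n, IsSplit (W _⦋n⦌)) (n : SimplexCategoryᵒᵖ) (y : (points W).V.obj n)
    (g : ℂ ≃ₐ[ℝ] ℂ) (h : g • y = y) : g = 1 :=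
  (hW n.unop.len).eq_one_of_galMap_comp_eq (y := y) h

/-- Galois equivariance is all that is needed of a map on `ℂ`-points to come from a morphism, so
that equivariant homotopy theory applies. -/
theorem nonempty_hom_of_isHypercovering (hW : ∀ n, IsSplit (W _⦋n⦌))
    (hU : IsHypercovering (Scheme.ProEt.precoverage specReal) U) : Nonempty (W ⟶ U) := by
  obtain ⟨φ⟩ := nonempty_equivariantMap (eq_one_of_smul_points_eq hW) hU.exists_points_lift
  choose f hf using fun n : SimplexCategoryᵒᵖ => (hW n.unop.len).exists_hom
    (fun y => φ.hom.app n y) fun g y => hom_app_smul φ g y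
  refine ⟨{ app := f, naturality := fun m n a => (hW m.unop.len).hom_ext fun y => ?_ }⟩
  have h₁ : y ≫ W.map a ≫ f n = φ.hom.app n (y ≫ W.map a) :=
    (Category.assoc _ _ _).symm.trans (hf n _)
  refine h₁.trans ((NatTrans.naturality_apply φ.hom a y).trans ?_)
  exact (congrArg (· ≫ U.map a) (hf m y)).symm.trans (Category.assoc _ _ _)

theorem nonempty_homotopy_of_isHypercovering (hW : ∀ n, IsSplit (W _⦋n⦌))
    (hU : IsHypercovering (Scheme.ProEt.precoverage specReal) U) (f g : W ⟶ U) :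
    Nonempty (SimplicialObject.Homotopy f g) := by
  obtain ⟨H, hH⟩ := exists_equivariant_homotopy (eq_one_of_smul_points_eq hW)
    hU.exists_points_lift (pointsMap f) (pointsMap g)
  have key {n : ℕ} (i : Fin (n + 1)) := (hW n).exists_hom (Z := U _⦋n + 1⦌)
    (fun y => H.h i y) fun g y => hH n i g y
  choose h hh using @key
  have e {n m : ℕ} {a b : W _⦋n⦌ ⟶ U _⦋m⦌} (hab : ∀ y : specComplex ⟶ W _⦋n⦌, y ≫ a = y ≫ b) :
      a = b := (hW n).hom_ext hab
  have hU' {n m : ℕ} (i : Fin (n + 1)) (a : U _⦋n + 1⦌ ⟶ U _⦋m⦌) (y : specComplex ⟶ W _⦋n⦌) :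
      y ≫ h i ≫ a = (H.h i y : specComplex ⟶ U _⦋n + 1⦌) ≫ a :=
    (Category.assoc _ _ _).symm.trans (congrArg (· ≫ a) (hh i y))
  have hW' {n m : ℕ} (i : Fin (n + 1)) (a : W _⦋m⦌ ⟶ W _⦋n⦌) (y : specComplex ⟶ W _⦋m⦌) :
      y ≫ a ≫ h i = H.h i (y ≫ a) :=
    (Category.assoc _ _ _).symm.trans (hh i _)
  -- the identities which hold on `ℂ`-points
  have e₀ (n : ℕ) (y : specComplex ⟶ W _⦋n⦌) :
      (H.h 0 y : specComplex ⟶ U _⦋n + 1⦌) ≫ U.δ 0 = y ≫ g.app (op ⦋n⦌) :=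
    ConcreteCategory.congr_hom (H.h_zero_comp_δ_zero n) y
  have e₁ (n : ℕ) (y : specComplex ⟶ W _⦋n⦌) :
      (H.h (Fin.last n) y : specComplex ⟶ U _⦋n + 1⦌) ≫ U.δ (Fin.last (n + 1)) =
        y ≫ f.app (op ⦋n⦌) :=
    ConcreteCategory.congr_hom (H.h_last_comp_δ_last n) y
  have e₂ {n : ℕ} (i : Fin (n + 2)) (j : Fin (n + 1)) (hij : i ≤ j.castSucc)
      (y : specComplex ⟶ W _⦋n + 1⦌) :
      (H.h j.succ y : specComplex ⟶ U _⦋n + 2⦌) ≫ U.δ i.castSucc = H.h j (y ≫ W.δ i) :=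
    ConcreteCategory.congr_hom (H.h_succ_comp_δ_castSucc_of_lt i j hij) y
  have e₃ {n : ℕ} (j : Fin (n + 1)) (y : specComplex ⟶ W _⦋n + 1⦌) :
      (H.h j.succ y : specComplex ⟶ U _⦋n + 2⦌) ≫ U.δ j.castSucc.succ =
        (H.h j.castSucc y : specComplex ⟶ U _⦋n + 2⦌) ≫ U.δ j.castSucc.succ :=
    ConcreteCategory.congr_hom (H.h_succ_comp_δ_castSucc_succ j) y
  have e₄ {n : ℕ} (i : Fin (n + 2)) (j : Fin (n + 1)) (hij : j.castSucc < i)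
      (y : specComplex ⟶ W _⦋n + 1⦌) :
      (H.h j.castSucc y : specComplex ⟶ U _⦋n + 2⦌) ≫ U.δ i.succ = H.h j (y ≫ W.δ i) :=
    ConcreteCategory.congr_hom (H.h_castSucc_comp_δ_succ_of_lt i j hij) y
  have e₅ {n : ℕ} (i j : Fin (n + 1)) (hij : i ≤ j) (y : specComplex ⟶ W _⦋n⦌) :
      (H.h j y : specComplex ⟶ U _⦋n + 1⦌) ≫ U.σ i.castSucc = H.h j.succ (y ≫ W.σ i) :=
    ConcreteCategory.congr_hom (H.h_comp_σ_castSucc_of_le i j hij) y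
  have e₆ {n : ℕ} (i j : Fin (n + 1)) (hij : j ≤ i) (y : specComplex ⟶ W _⦋n⦌) :
      (H.h j y : specComplex ⟶ U _⦋n + 1⦌) ≫ U.σ i.succ = H.h j.castSucc (y ≫ W.σ i) :=
    ConcreteCategory.congr_hom (H.h_comp_σ_succ_of_lt i j hij) y
  exact ⟨{
    h := h
    h_zero_comp_δ_zero n := e fun y => (hU' _ _ y).trans (e₀ n y)
    h_last_comp_δ_last n := e fun y => (hU' _ _ y).trans (e₁ n y)
    h_succ_comp_δ_castSucc_of_lt i j hij := e fun y =>
      (hU' _ _ y).trans ((e₂ i j hij y).trans (hW' _ _ y).symm)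
    h_succ_comp_δ_castSucc_succ j := e fun y =>
      (hU' _ _ y).trans ((e₃ j y).trans (hU' _ _ y).symm)
    h_castSucc_comp_δ_succ_of_lt i j hij := e fun y =>
      (hU' _ _ y).trans ((e₄ i j hij y).trans (hW' _ _ y).symm)
    h_comp_σ_castSucc_of_le i j hij := e fun y =>
      (hU' _ _ y).trans ((e₅ i j hij y).trans (hW' _ _ y).symm)
    h_comp_σ_succ_of_lt i j hij := e fun y =>
      (hU' _ _ y).trans ((e₆ i j hij y).trans (hW' _ _ y).symm) }⟩

/-- A hypercovering which is split in each degree is an initial object of the homotopy category of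
hypercoverings. -/
theorem nonempty_isInitial_of_isSplit (hW : ∀ n, IsSplit (W _⦋n⦌))
    (hW' : IsHypercovering (Scheme.ProEt.precoverage specReal) W) :
    Nonempty (IsInitial (HoHy.of W hW')) := by
  have h₁ (d : HoHy specReal) : Nonempty (HoHy.of W hW' ⟶ d) := by
    obtain ⟨⟨U, hU⟩⟩ := d
    obtain ⟨f⟩ := nonempty_hom_of_isHypercovering hW hU
    exact ⟨(CategoryTheory.Quotient.functor _).map (ObjectProperty.homMk f)⟩
  have h₂ (d : HoHy specReal) (a b : HoHy.of W hW' ⟶ d) : a = b := by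
    obtain ⟨⟨U, hU⟩⟩ := d
    obtain ⟨f, rfl⟩ := (CategoryTheory.Quotient.functor _).map_surjective a
    obtain ⟨g, rfl⟩ := (CategoryTheory.Quotient.functor _).map_surjective b
    exact CategoryTheory.Quotient.sound _ (nonempty_homotopy_of_isHypercovering hW hU f.hom g.hom)
  exact ⟨IsInitial.ofUniqueHom (fun d => (h₁ d).some) fun d m => h₂ d _ _⟩

end SplitSimplicialObjects

section ProObjects

universe w' w v u

variable {C : Type u} [Category.{v} C]

/-- The projection of a pro-object to its value at an initial object of the index category is an
isomorphism. -/
theorem ProObject.isIso_proj (X : ProObject.{w', w} C) (i : X.J) (hi : IsInitial i) :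
    IsIso (X.proj i) := by
  let Y : ProObject.{w', w} C := const (X.diagram.obj i)
  have hY (k k' : Y.J) : k = k' := by
    obtain ⟨⟨⟨⟩⟩⟩ := k
    obtain ⟨⟨⟨⟩⟩⟩ := k'
    rfl
  let k : Y.J := ULiftHom.objUp.{w, w'} ⟨⟨PUnit.unit⟩⟩
  let ψ : Hom Y X :=
    { app j := Germ.mk k (X.diagram.map (hi.to j))
      compat a := congrArg (Germ.mk (X := Y) k) ((X.diagram.map_comp _ _).symm.trans
        (congrArg X.diagram.map (hi.hom_ext _ _))) }
  refine ⟨ψ, Hom.ext (funext fun j => ?_), Hom.ext (funext fun k' => ?_)⟩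
  · change (Germ.mk (X := X) i (𝟙 _)).post (X.diagram.map (hi.to j)) = Germ.mk j (𝟙 _)
    rw [← Germ.mk_map (hi.to j), Germ.post_mk, Category.id_comp, Category.comp_id]
  · obtain rfl := hY k k'
    change (Germ.mk (X := Y) k (X.diagram.map (hi.to i))).post (𝟙 _) = Germ.mk k (𝟙 _)
    rw [Germ.post_id, hi.hom_ext (hi.to i) (𝟙 i), CategoryTheory.Functor.map_id]
    rfl

/-- The morphism of constant pro-objects induced by a morphism. -/
def ProObject.constMap {c d : C} (f : c ⟶ d) : (const c : ProObject.{w', w} C) ⟶ const d :=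
  Hom.mk (fun k => Germ.mk (X := const c) k f) fun {k _} a =>
    ((congrArg (Germ.mk (X := const c) (c := d) k) (Category.comp_id f)).trans
      (congrArg (Germ.mk (X := const c) (c := d) k) (Category.id_comp f)).symm).trans
        (Germ.mk_map (X := const c) (c := d) a f)

/-- Constant pro-objects on isomorphic objects are isomorphic. -/
def ProObject.constIso {c d : C} (e : c ≅ d) :
    (const c : ProObject.{w', w} C) ≅ const d where
  hom := constMap e.hom
  inv := constMap e.inv
  hom_inv_id := Hom.ext (funext fun k => congrArg (Germ.mk (X := const c) k) e.hom_inv_id)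
  inv_hom_id := Hom.ext (funext fun k => congrArg (Germ.mk (X := const d) k) e.inv_hom_id)

end ProObjects

/-! ### Splittings -/

section Splitting

/-- Nondegeneracy of `ℂ`-points is Galois invariant, as degeneracies are preserved by `g⁻¹`. -/
theorem smul_mem_nonDegenerate {W : SimplicialObject specReal.ProEt} {n : ℕ} (g : ℂ ≃ₐ[ℝ] ℂ)
    {y : (points W).V _⦋n⦌} (hy : y ∈ (points W).V.nonDegenerate n) :
    g • y ∈ (points W).V.nonDegenerate n := by
  intro h
  refine hy ?_
  have := SSet.degenerate_app_apply h ((points W).ρ g⁻¹ : (points W).V ⟶ (points W).V)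
  have e : NatTrans.app ((points W).ρ g⁻¹ : (points W).V ⟶ (points W).V) (op ⦋n⦌) (g • y) = y :=
    inv_smul_smul g y
  rwa [e] at this

/-- A simplicial object which is a coproduct of copies of `Spec ℂ` in each degree is split: the
nondegenerate `ℂ`-points form summands. -/
theorem nonempty_splitting_of_isSplit {W : SimplicialObject specReal.ProEt}
    (hW : ∀ n, IsSplit (W _⦋n⦌)) : Nonempty (SimplicialObject.Splitting W) := by
  choose N hN ι hι hι' using fun n => (hW n).exists_summand ((points W).V.nonDegenerate n)
    fun g y hy => smul_mem_nonDegenerate g hy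
  have key (Δ : SimplexCategoryᵒᵖ) :
      Nonempty (IsColimit (SimplicialObject.Splitting.cofan' N W ι Δ)) := by
    refine (hW Δ.unop.len).nonempty_isColimit
      (SimplicialObject.Splitting.summand N Δ) (fun A => hN A.1.unop.len) _ fun y => ?_
    obtain ⟨⟨n⟩⟩ := Δ
    obtain ⟨m, f, hf, ⟨z, hz⟩, hy⟩ := SSet.exists_nonDegenerate (points W).V (n := n) y
    obtain ⟨x, rfl⟩ := (hι' m z).1 hz
    refine ⟨⟨SimplicialObject.Splitting.IndexSet.mk f, x⟩, ?_, ?_⟩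
    · exact (Category.assoc _ _ _).symm.trans hy.symm
    · rintro ⟨⟨⟨⟨m'⟩⟩, f', hf'⟩, x'⟩ hy'
      let z' : (points W).V.nonDegenerate m' := ⟨x' ≫ ι m', (hι' m' _).2 ⟨x', rfl⟩⟩
      have hz' : y = (points W).V.map f'.op z'.1 := hy'.symm.trans (Category.assoc _ _ _).symm
      obtain rfl : m = m' := SSet.unique_nonDegenerate_dim (X := (points W).V) y f _ hy f' z' hz'
      obtain rfl : f = f' := SSet.unique_nonDegenerate_map (X := (points W).V) y f _ hy f' z' hz'
      have h := SSet.unique_nonDegenerate_simplex (X := (points W).V) y f _ hy f z' hz'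
      obtain rfl : x = x' := hι m _ _ (congrArg Subtype.val h)
      rfl
  exact ⟨{ N := N, ι := ι, isColimit' := fun Δ => (key Δ).some }⟩

end Splitting

/-! ### Underlying spaces and classifying spaces -/

universe t

section UnderlyingSpace

/-- The image of a `ℂ`-point in the underlying space. -/
noncomputable def imagePoint {V : specReal.ProEt} (y : specComplex ⟶ V) : V.left :=
  (underlyingScheme specReal).map y (⊥ : PrimeSpectrum ℂ)

theorem imagePoint_comp {V Z : specReal.ProEt} (y : specComplex ⟶ V) (f : V ⟶ Z) :
    imagePoint (y ≫ f) = (underlyingScheme specReal).map f (imagePoint y) := by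
  unfold imagePoint
  rw [Functor.map_comp]
  rfl

theorem imagePoint_galMap_comp {V : specReal.ProEt} (g : ℂ ≃ₐ[ℝ] ℂ) (y : specComplex ⟶ V) :
    imagePoint (galMap g ≫ y) = imagePoint y := by
  rw [imagePoint_comp]
  exact congrArg ((underlyingScheme specReal).map y)
    (Subsingleton.elim (α := PrimeSpectrum ℂ) _ _)

theorem galMap_surjective (y : specComplex ⟶ specComplex) : ∃ g, y = galMap g := by
  obtain ⟨⟨⟨⟩, g⟩, hg, -⟩ := existsUnique_copiesInj (ι := Unit) (y ≫ copiesInj ())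
  exact ⟨g, copiesInj_cancel hg.symm⟩

theorem galMap_injective : Function.Injective galMap := by
  intro g h e
  have : galMap (h⁻¹ * g) ≫ 𝟙 specComplex = 𝟙 specComplex := by
    rw [galMap_mul, e, ← galMap_mul, inv_mul_cancel, galMap_one, Category.comp_id]
  exact (inv_mul_eq_one.1 (isSplit_specComplex.eq_one_of_galMap_comp_eq this)).symm

theorem IsSplit.discreteTopology {V : specReal.ProEt} (hV : IsSplit V) :
    DiscreteTopology V.left := by
  obtain ⟨ι, _, ⟨e⟩⟩ := hV
  have : DiscreteTopology (copies ι).left :=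
    inferInstanceAs (DiscreteTopology (PrimeSpectrum (ι → ℂ)))
  let e' : V.left ≅ (copies ι).left := (underlyingScheme specReal).mapIso e.symm
  exact e'.hom.homeomorph.isEmbedding.discreteTopology

theorem IsSplit.imagePoint_surjective {V : specReal.ProEt} (hV : IsSplit V) (x : V.left) :
    ∃ y : specComplex ⟶ V, imagePoint y = x := by
  obtain ⟨ι, _, ⟨e⟩⟩ := hV
  let e' : (copies ι).left ≅ V.left := (underlyingScheme specReal).mapIso e
  obtain ⟨z, rfl⟩ := e'.hom.homeomorph.surjective x
  obtain ⟨i, a, rfl⟩ := exists_specMap_evalRingHom z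
  refine ⟨copiesInj i ≫ e.hom, (imagePoint_comp _ _).trans (congrArg e'.hom ?_)⟩
  exact congrArg (Spec.map (CommRingCat.ofHom (Pi.evalRingHom (fun _ : ι => ℂ) i)))
    (Subsingleton.elim (α := PrimeSpectrum ℂ) _ _)

/-- The points of a split object are the Galois orbits of its `ℂ`-points. -/
theorem IsSplit.exists_galMap_of_imagePoint_eq {V : specReal.ProEt} (hV : IsSplit V)
    {y y' : specComplex ⟶ V} (h : imagePoint y = imagePoint y') :
    ∃ g : ℂ ≃ₐ[ℝ] ℂ, galMap g ≫ y = y' := by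
  obtain ⟨ι, _, ⟨e⟩⟩ := hV
  obtain ⟨⟨i, g⟩, hg, -⟩ := existsUnique_copiesInj (y ≫ e.inv)
  obtain ⟨⟨j, g'⟩, hg', -⟩ := existsUnique_copiesInj (y' ≫ e.inv)
  have h' : imagePoint (y ≫ e.inv) = imagePoint (y' ≫ e.inv) := by
    rw [imagePoint_comp, imagePoint_comp, h]
  rw [← hg, ← hg', imagePoint_galMap_comp, imagePoint_galMap_comp] at h'
  obtain rfl : i = j := by
    by_contra hij
    exact specMap_evalRingHom_ne hij _ _ h'
  refine ⟨g' * g⁻¹, (cancel_mono e.inv).1 ?_⟩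
  dsimp only at hg hg'
  rw [Category.assoc, ← hg, ← hg', ← Category.assoc, ← galMap_mul, inv_mul_cancel_right]

end UnderlyingSpace

section Nerve

variable {H : Type} [Group H]

/-- The element of the group which belongs to the edge from the initial vertex to the vertex `i`
of a simplex in the nerve. -/
def initialEdge {n : ℕ} (F : ComposableArrows (SingleObj H) n) (i : Fin (n + 1)) : H :=
  F.map (homOfLE (Fin.zero_le i))

theorem initialEdge_eq_mul {n : ℕ} (F : ComposableArrows (SingleObj H) n) {i j : Fin (n + 1)}
    (f : i ⟶ j) : initialEdge F j = (show H from F.map f) * initialEdge F i :=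
  F.map_comp (homOfLE (Fin.zero_le i)) f

theorem initialEdge_zero {n : ℕ} (F : ComposableArrows (SingleObj H) n) : initialEdge F 0 = 1 :=
  F.map_id 0

theorem initialEdge_ext {n : ℕ} {F F' : ComposableArrows (SingleObj H) n}
    (h : ∀ i, initialEdge F i = initialEdge F' i) : F = F' := by
  refine CategoryTheory.Functor.ext (fun _ => rfl) fun i j f => ?_
  have h₁ := initialEdge_eq_mul F f
  rw [h, h, initialEdge_eq_mul F' f] at h₁
  refine (mul_right_cancel h₁).symm.trans ?_
  simp

theorem exists_initialEdge_eq {n : ℕ} (g : Fin (n + 1) → H) :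
    ∃ F : ComposableArrows (SingleObj H) n, ∀ i, initialEdge F i = g i * (g 0)⁻¹ :=
  ⟨SingleObj.differenceFunctor g, fun _ => rfl⟩

/-- The simplicial structure of the nerve, in terms of sequences of composable arrows. -/
def reindex {m n : SimplexCategory} (a : m ⟶ n) (F : ComposableArrows (SingleObj H) n.len) :
    ComposableArrows (SingleObj H) m.len :=
  F.whiskerLeft (SimplexCategory.toCat.map a).toFunctor

theorem initialEdge_map {m n : SimplexCategory} (a : m ⟶ n)
    (F : ComposableArrows (SingleObj H) n.len) (i : Fin (m.len + 1)) :
    initialEdge F (a.toOrderHom i) = initialEdge (reindex a F) i * initialEdge F (a.toOrderHom 0) :=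
  initialEdge_eq_mul F (homOfLE (a.toOrderHom.monotone (Fin.zero_le i)))

/-- The simplicial space underlying the `0`-coskeleton of `Spec ℂ` is the classifying space of the
Galois group. A simplex of the nerve corresponds to the image of the `ℂ`-point whose coordinate at
each vertex is given by the edge to this vertex. -/
theorem nonempty_underlyingSpace_cosk₀_iso (e : H ≃* (ℂ ≃ₐ[ℝ] ℂ)) :
    Nonempty (((SimplicialObject.whiskering _ _).obj (underlyingSpace specReal)).obj
      (cosk₀ specComplex) ≅ classifyingSpace H) := by
  let W := cosk₀ specComplex
  have hW (Δ : SimplexCategoryᵒᵖ) : IsSplit (W.obj Δ) := isSplit_cosk₀ Δ.unop.len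
  choose pt hpt using fun (Δ : SimplexCategoryᵒᵖ)
    (F : ComposableArrows (SingleObj H) Δ.unop.len) =>
      (existsUnique_coord specComplex (n := Δ.unop) fun i =>
        galMap (e (initialEdge F (i.toOrderHom 0)))⁻¹).exists
  -- the points `pt Δ F` are compatible with the simplicial structure only up to the action
  have hmap {Δ Δ' : SimplexCategoryᵒᵖ} (a : Δ ⟶ Δ')
      (F : ComposableArrows (SingleObj H) Δ.unop.len) :
      pt Δ F ≫ W.map a = galMap (e (initialEdge F (a.unop.toOrderHom 0)))⁻¹ ≫
        pt Δ' (reindex a.unop F) := by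
    refine hom_coord_ext specComplex fun i => ?_
    rw [Category.assoc, Category.assoc, hpt, ← galMap_mul]
    refine (congrArg (pt Δ F ≫ ·) (map_coord specComplex a.unop i)).trans ((hpt _ _ _).trans ?_)
    rw [← mul_inv_rev, ← map_mul]
    exact congrArg (fun x => galMap (e x)⁻¹) (initialEdge_map a.unop F (i.toOrderHom 0))
  have hbij (Δ : SimplexCategoryᵒᵖ) : Function.Bijective fun F => imagePoint (pt Δ F) := by
    refine ⟨fun F F' h => ?_, fun x => ?_⟩
    · obtain ⟨g, hg⟩ := (hW Δ).exists_galMap_of_imagePoint_eq h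
      have hg' (i : ⦋0⦌ ⟶ Δ.unop) : g * (e (initialEdge F (i.toOrderHom 0)))⁻¹ =
          (e (initialEdge F' (i.toOrderHom 0)))⁻¹ := galMap_injective <| by
        rw [galMap_mul, ← hpt, ← hpt, ← hg, Category.assoc]
      obtain rfl : g = 1 := by
        have := hg' (SimplexCategory.const _ _ 0)
        change g * (e (initialEdge F 0))⁻¹ = (e (initialEdge F' 0))⁻¹ at this
        simpa [initialEdge_zero] using this
      refine initialEdge_ext fun i => ?_
      have := hg' (SimplexCategory.const _ _ i)
      rw [one_mul] at this
      exact e.injective (inv_injective this)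
    · obtain ⟨y, rfl⟩ := (hW Δ).imagePoint_surjective x
      choose g hg using fun i : Fin (Δ.unop.len + 1) =>
        galMap_surjective (y ≫ coord specComplex (SimplexCategory.const ⦋0⦌ Δ.unop i))
      obtain ⟨F, hF⟩ := exists_initialEdge_eq fun i => e.symm (g i)⁻¹
      refine ⟨F, ?_⟩
      have : pt Δ F = galMap (g 0)⁻¹ ≫ y := by
        refine hom_coord_ext specComplex fun i => ?_
        obtain ⟨k, rfl⟩ : ∃ k, i = SimplexCategory.const ⦋0⦌ Δ.unop k :=
          ⟨_, SimplexCategory.eq_const_of_zero i⟩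
        rw [hpt, Category.assoc, hg, ← galMap_mul]
        change galMap (e (initialEdge F k))⁻¹ = _
        rw [hF]
        simp
      dsimp only
      rw [this, imagePoint_galMap_comp]
  have hdisc (Δ : SimplexCategoryᵒᵖ) : DiscreteTopology ((underlyingSpace specReal).obj (W.obj Δ)) :=
    (hW Δ).discreteTopology
  let φ (Δ : SimplexCategoryᵒᵖ) : (classifyingSpace H).obj Δ ≅
      (underlyingSpace specReal).obj (W.obj Δ) :=
    TopCat.isoOfHomeo
      { toEquiv := Equiv.ofBijective (fun F => imagePoint (pt Δ F)) (hbij Δ)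
        continuous_toFun := continuous_bot
        continuous_invFun := continuous_of_discreteTopology }
  refine ⟨(NatIso.ofComponents φ fun {Δ Δ'} a => ?_).symm⟩
  ext F
  change imagePoint (pt Δ' (reindex a.unop F)) =
    (underlyingScheme specReal).map (W.map a) (imagePoint (pt Δ F))
  exact (imagePoint_galMap_comp _ _).symm.trans
    ((congrArg imagePoint (hmap a F)).symm.trans (imagePoint_comp _ _))

end Nerve

section Components

/-- A totally disconnected space is its own space of components. -/
def componentsIsoOfTotallyDisconnected (Y : TopCat.{t}) [TotallyDisconnectedSpace Y] :
    spaceOfComponents.obj Y ≅ Y where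
  hom := TopCat.ofHom ⟨_, (continuous_id (X := Y)).connectedComponentsLift_continuous⟩
  inv := TopCat.ofHom ⟨_, ConnectedComponents.continuous_coe⟩
  hom_inv_id := by
    ext x
    obtain ⟨x, rfl⟩ := ConnectedComponents.surjective_coe x
    rfl
  inv_hom_id := rfl

/-- Taking components does not change discrete spaces. -/
def discreteComponentsIso : TopCat.discrete.{t} ⋙ spaceOfComponents ≅ TopCat.discrete.{t} :=
  NatIso.ofComponents
    (fun X =>
      have : DiscreteTopology (TopCat.discrete.obj X) := ⟨rfl⟩
      componentsIsoOfTotallyDisconnected (TopCat.discrete.obj X))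
    (by
      intro X Y f
      ext x
      obtain ⟨x, rfl⟩ := ConnectedComponents.surjective_coe x
      rfl)

theorem nonempty_components_cosk₀_iso {H : Type} [Group H] (e : H ≃* (ℂ ≃ₐ[ℝ] ℂ)) :
    Nonempty (((SimplicialObject.whiskering _ _).obj (components specReal)).obj
      (cosk₀ specComplex) ≅ classifyingSpace H) := by
  obtain ⟨φ⟩ := nonempty_underlyingSpace_cosk₀_iso e
  exact ⟨Functor.isoWhiskerRight φ spaceOfComponents ≪≫
    Functor.isoWhiskerLeft (nerve (SingleObj H)) discreteComponentsIso⟩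

end Components

/-! ### The homotopy type -/

section GaloisGroup

theorem nonempty_galoisGroup_mulEquiv :
    Nonempty ((ℂ ≃ₐ[ℝ] ℂ) ≃* Multiplicative (ZMod 2)) := by
  have : Fact (Nat.Prime 2) := ⟨Nat.prime_two⟩
  have hc : IsCyclic (ℂ ≃ₐ[ℝ] ℂ) := isCyclic_of_prime_card natCard_galoisGroup
  exact ⟨mulEquivOfCyclicCardEq (by rw [natCard_galoisGroup]; simp)⟩

end GaloisGroup

end ProEtaleHomotopy

open ProEtaleHomotopy

theorem mainTheorem10 :
    -- the Galois group of `ℂ` over `ℝ` is `ℤ/2ℤ`, and thereby discrete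
    (Nonempty ((ℂ ≃ₐ[ℝ] ℂ) ≃* Multiplicative (ZMod 2)) ∧ DiscreteTopology (ℂ ≃ₐ[ℝ] ℂ)) ∧
    -- `cosk₀(Spec ℂ)` is affine and weakly contractible in each degree, and it is split
    (∀ n : ℕ, IsAffine ((cosk₀ specComplex) _⦋n⦌).left ∧
      IsWeaklyContractible ((cosk₀ specComplex) _⦋n⦌)) ∧
    Nonempty (SimplicialObject.Splitting (cosk₀ specComplex)) ∧
    -- its underlying simplicial space is the classifying space of the Galois group
    Nonempty (((SimplicialObject.whiskering _ _).obj (underlyingSpace specReal)).obj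
      (cosk₀ specComplex) ≅ classifyingSpace (ℂ ≃ₐ[ℝ] ℂ)) ∧
    -- its simplicial space of components is the classifying space of `ℤ/2ℤ`
    Nonempty (((SimplicialObject.whiskering _ _).obj (components specReal)).obj
      (cosk₀ specComplex) ≅ classifyingSpace (Multiplicative (ZMod 2))) ∧
    -- it is a hypercovering, and hypercoverings modulo homotopy form a cofiltered category
    ∃ (hW : IsHypercovering (Scheme.ProEt.precoverage specReal) (cosk₀ specComplex))
      (_ : IsCofiltered (HoHy specReal)),
      -- its inclusion into the homotopy category of hypercoverings is initial
      (Functor.fromPUnit.{0} (HoHy.of (cosk₀ specComplex) hW)).Initial ∧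
      -- so the projection of the pro-étale homotopy type to `π(cosk₀(Spec ℂ))` is an isomorphism
      IsIso ((proEtaleHomotopyType specReal).proj (HoHy.of (cosk₀ specComplex) hW)) ∧
      -- and the pro-étale homotopy type of `Spec ℝ` is the classifying space of `ℤ/2ℤ`
      Nonempty (proEtaleHomotopyType specReal ≅
        ProObject.const (toHo (classifyingSpace (Multiplicative (ZMod 2))))) := by
  obtain ⟨e⟩ := nonempty_galoisGroup_mulEquiv
  have hW := isHypercovering_cosk₀_specComplex
  obtain ⟨hi⟩ := nonempty_isInitial_of_isSplit isSplit_cosk₀ hW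
  have hc : IsCofiltered (HoHy specReal) := IsCofiltered.of_isInitial _ hi
  have hp : IsIso ((proEtaleHomotopyType specReal).proj (HoHy.of (cosk₀ specComplex) hW)) :=
    ProObject.isIso_proj (proEtaleHomotopyType specReal) _ hi
  obtain ⟨φ⟩ := nonempty_components_cosk₀_iso e.symm
  refine ⟨⟨⟨e⟩, inferInstance⟩, fun n => ⟨(isSplit_cosk₀ n).isAffine,
    (isSplit_cosk₀ n).isWeaklyContractible⟩, nonempty_splitting_of_isSplit isSplit_cosk₀,
    nonempty_underlyingSpace_cosk₀_iso (MulEquiv.refl _), ⟨φ⟩, hW, hc,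
    Functor.initial_fromPUnit_of_isInitial hi, hp, ⟨?_⟩⟩
  -- the value of the pro-object at the initial hypercovering is `π(cosk₀(Spec ℂ))`
  exact @asIso _ _ _ _ _ hp ≪≫ ProObject.constIso
    ((CategoryTheory.Quotient.functor (homotopyRel TopCat.{0})).mapIso φ)
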